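/- Let $S$ and $R$ be finite commutative chain rings (local rings whose ideals form a chain under inclusion) such that $R$ is the Galois extension of $S$ of degree $w$, i.e. $R\simeq S[x]/\langle f\rangle$ as $S$-algebras for some monic polynomial $f\in S[x]$ of degree $w$ that is irreducible modulo the maximal ideal of $S$. Assume that $w\ge 2$ is even. Let $\sigma$ be a generator of the (cyclic) group $\mathrm{Aut}_S(R)$, let $\gamma\in R$ be a generator of the maximal ideal of $R$, and let $e\ge 2$ be the least integer with $\gamma^e=0$. Let $s$ be an integer with $1\le s<e$, put $\check R=R/\gamma^sR$, let $a,b\ge 1$ be integers, and let $\mathbf M=R^a\oplus\check R^b$, regarded as an $R$-module. An $R\check R$-linear code of block-length $(a,b)$ is an $R$-submodule of $\mathbf M$. For $m=(c_1,\dots,c_a\,|\,d_1,\dots,d_b)$ and $m'=(c_1',\dots,c_a'\,|\,d_1',\dots,d_b')$ in $\mathbf M$, let $$\langle m,m'\rangle=\sum_{i=1}^a c_i\,\sigma^{w/2}(c_i')+\gamma^{e-s}\sum_{j=1}^b d_j\,\sigma^{w/2}(d_j')\in R,$$ where the entries $d_j,d_j'\in\check R$ are replaced by any representatives in $R$ (the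 value does not depend on the choice). A code $C$ is called Hermitian LCD if $C\cap C^{\perp}=\{0\}$, where $C^{\perp}=\{m\in\mathbf M:\langle m,m'\rangle=0\text{ for all }m'\in C\}$. Then the residue field of $R$ has order $q=q_1^2$ for some prime power $q_1$, and the number of Hermitian LCD $R\check R$-linear codes of block-length $(a,b)$ equals $$\sum_{k_0=0}^{a}\sum_{\ell_0=0}^{b}M(a,k_0)\,M(b,\ell_0)\,q^{(a-k_0)(s\ell_0+(e-1)k_0)+(b-\ell_0)(sk_0+(s-1)\ell_0)},$$ where, for $0\le r\le n$, $$M(n,r)=q_1^{r(n-r)}\prod_{i=0}^{r-1}\frac{q_1^{n-i}-(-1)^{n-i}}{q_1^{r-i}-(-1)^{r-i}}.$$ -/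

import Mathlib

open Polynomial

/-- A commutative chain ring: a local ring whose ideals form a chain under inclusion. -/
class IsChainRing (A : Type*) [CommRing A] : Prop extends IsLocalRing A where
  ideal_le_total : ∀ I J : Ideal A, I ≤ J ∨ J ≤ I

/-- `R` is the Galois extension of the local ring `S` of degree `w`: there is a monic basic
irreducible polynomial `f` of degree `w` over `S` (i.e. irreducible modulo the maximal ideal)
such that `R ≃ S[x]/⟨f⟩` as `S`-algebras. -/
def IsGaloisExtensionOfDegree (S R : Type*) [CommRing S] [IsLocalRing S] [CommRing R]
    [Algebra S R] (w : ℕ) : Prop :=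
  ∃ f : S[X], f.Monic ∧ f.natDegree = w ∧
    Irreducible (f.map (IsLocalRing.residue S)) ∧ Nonempty (R ≃ₐ[S] AdjoinRoot f)

/-- The quotient ring `R / γ^s R`. -/
abbrev RCheck (R : Type*) [CommRing R] (γ : R) (s : ℕ) : Type _ :=
  R ⧸ Ideal.span {γ ^ s}

/-- The ambient `R`-module `R^a ⊕ (R / γ^s R)^b`. -/
abbrev MixedSpace (R : Type*) [CommRing R] (γ : R) (s a b : ℕ) : Type _ :=
  (Fin a → R) × (Fin b → RCheck R γ s)

/-- The inner product attached to an automorphism `τ` of `R`: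
`∑ cᵢ τ(c'ᵢ) + γ^(e-s) ∑ dⱼ τ(d'ⱼ)`. The elements of `R / γ^s R` are
replaced by representatives in `R`; by `mixedForm_eq_of_mk` below, the value does not depend on
the representatives. -/
noncomputable def mixedForm {R : Type*} [CommRing R] (τ : R → R) (γ : R) (e s : ℕ) {a b : ℕ}
    (m₁ m₂ : MixedSpace R γ s a b) : R :=
  ∑ i, m₁.1 i * τ (m₂.1 i) +
    γ ^ (e - s) * ∑ j, Quotient.out (m₁.2 j) * τ (Quotient.out (m₂.2 j))

theorem mixedForm_eq_of_mk {R : Type*} [CommRing R] [IsLocalRing R] (τ : R ≃+* R) (γ : R)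
    (e s : ℕ) (hγ : IsLocalRing.maximalIdeal R = Ideal.span {γ}) (he : γ ^ e = 0) (hse : s ≤ e)
    {a b : ℕ} (m₁ m₂ : MixedSpace R γ s a b) (d₁ d₂ : Fin b → R)
    (h₁ : ∀ j, Ideal.Quotient.mk (Ideal.span {γ ^ s}) (d₁ j) = m₁.2 j)
    (h₂ : ∀ j, Ideal.Quotient.mk (Ideal.span {γ ^ s}) (d₂ j) = m₂.2 j) :
    mixedForm τ γ e s m₁ m₂ =
      ∑ i, m₁.1 i * τ (m₂.1 i) + γ ^ (e - s) * ∑ j, d₁ j * τ (d₂ j) := by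
  have hτ : γ ∣ τ γ := by
    rw [← Ideal.mem_span_singleton, ← hγ, IsLocalRing.mem_maximalIdeal, mem_nonunits_iff,
      MulEquiv.isUnit_map, ← mem_nonunits_iff, ← IsLocalRing.mem_maximalIdeal, hγ]
    exact Ideal.mem_span_singleton_self γ
  have key : γ ^ (e - s) * γ ^ s = 0 := by rw [← pow_add, Nat.sub_add_cancel hse, he]
  have out_eq : ∀ (x : RCheck R γ s) (d : R), Ideal.Quotient.mk (Ideal.span {γ ^ s}) d = x →
      ∃ r, Quotient.out x = d + γ ^ s * r := by
    intro x d hd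
    have : Ideal.Quotient.mk (Ideal.span {γ ^ s}) (Quotient.out x) =
        Ideal.Quotient.mk (Ideal.span {γ ^ s}) d := by
      rw [hd]; exact Ideal.Quotient.mk_out x
    rw [Ideal.Quotient.eq, Ideal.mem_span_singleton] at this
    obtain ⟨r, hr⟩ := this
    exact ⟨r, by rw [← hr]; ring⟩
  unfold mixedForm
  congr 1
  rw [Finset.mul_sum, Finset.mul_sum]
  refine Finset.sum_congr rfl fun j _ => ?_
  obtain ⟨r, hr⟩ := out_eq _ _ (h₁ j)
  obtain ⟨t, ht⟩ := out_eq _ _ (h₂ j)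
  obtain ⟨c, hc⟩ := pow_dvd_pow_of_dvd hτ s
  rw [hr, ht, map_add, map_mul, map_pow, hc]
  linear_combination
    (r * (τ (d₂ j) + γ ^ s * c * τ t) + d₁ j * c * τ t) * key

/-- The `h`-Galois inner product on `R^a ⊕ (R / γ^s R)^b`, where `σ` is the Frobenius
automorphism of `R` over `S`. -/
noncomputable def galoisInner {S R : Type*} [CommRing S] [CommRing R] [Algebra S R]
    (σ : R ≃ₐ[S] R) (h : ℕ) (γ : R) (e s : ℕ) {a b : ℕ}
    (m₁ m₂ : MixedSpace R γ s a b) : R :=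
  mixedForm (⇑(σ ^ h : R ≃ₐ[S] R)) γ e s m₁ m₂

/-- The `h`-Galois dual of a linear code of block-length `(a, b)`. -/
def galoisDual {S R : Type*} [CommRing S] [CommRing R] [Algebra S R]
    (σ : R ≃ₐ[S] R) (h : ℕ) (γ : R) (e s : ℕ) {a b : ℕ}
    (C : Submodule R (MixedSpace R γ s a b)) : Set (MixedSpace R γ s a b) :=
  {m₁ | ∀ m₂ ∈ C, galoisInner σ h γ e s m₁ m₂ = 0}

/-- A linear code is `h`-Galois LCD if it meets its `h`-Galois dual only in `0`. -/
def IsGaloisLCD {S R : Type*} [CommRing S] [CommRing R] [Algebra S R]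
    (σ : R ≃ₐ[S] R) (h : ℕ) (γ : R) (e s : ℕ) {a b : ℕ}
    (C : Submodule R (MixedSpace R γ s a b)) : Prop :=
  (C : Set (MixedSpace R γ s a b)) ∩ galoisDual σ h γ e s C = {0}

/-- `q₁^(r(n-r)) ∏_{i<r} (q₁^(n-i) - (-1)^(n-i)) / (q₁^(r-i) - (-1)^(r-i))`, for `r ≤ n`. -/
def hermitianCount (q₁ n r : ℕ) : ℚ :=
  (q₁ : ℚ) ^ (r * (n - r)) *
    ∏ i ∈ Finset.range r,
      (((q₁ : ℚ) ^ (n - i) - (-1) ^ (n - i)) / ((q₁ : ℚ) ^ (r - i) - (-1) ^ (r - i)))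

/-! Write `K` for the residue field. A generator of `Aut_S(R)` reduces to a generator of the Galois
group of `K` over the residue field of `S`, so `σ ^ (w / 2)` reduces to its involution. Hence `K`
has `q ^ 2` elements and the form reduces to Hermitian forms for `x ↦ x ^ q`
(`exists_isQuadraticFrobenius`).

The radical `C ∩ C^⊥` is stable under `γ`, which is nilpotent, so if it is nonzero it contains a
nonzero element killed by `γ`. Such an element is `(γ^(e-1) c | γ^(s-1) d)`, and its product with
`m` is `γ^(e-1)` times a lift of the sum of the Hermitian products of the reductions. LCD is
therefore a condition over `K` (`lcd_iff`).

From that condition, Gram–Schmidt over `K` and successive approximation in powers of `γ` show that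
an LCD code is generated by a frame: elements `u_i` with orthonormal first-block reductions, and
elements `v_j` killed by `γ^s` with orthonormal second-block reductions (`SocleLCD.exists_frame`).
Conversely a frame of type `(k, l)` embeds `R^k ⊕ (R/γ^s R)^l` onto an LCD code
(`IsFrame.socleLCD`), and the embedding matches the frames of the code with those of the model space
(`IsFrame.comp_iff`).

Double counting thus gives the number of LCD codes of type `(k, l)` as a quotient of two frame
counts. Each of these is a number of orthonormal families over `K` times a power of `q` counting
lifts. The quotients of the former are the factors `M`; those of the latter give the exponent. -/

/-! ### Norms and fixed elements for the quadratic Frobenius -/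

/-- `φ` is the Frobenius `x ↦ x ^ q` of a field with `q ^ 2` elements. -/
structure IsQuadraticFrobenius {K : Type*} [Field K] (φ : K →+* K) (q : ℕ) : Prop where
  card : Nat.card K = q ^ 2
  apply : ∀ x, φ x = x ^ q

namespace IsQuadraticFrobenius

variable {K : Type*} [Field K] [Finite K] {φ : K →+* K} {q : ℕ}


theorem two_le (h : IsQuadraticFrobenius φ q) : 2 ≤ q := by
  have h1 : 1 < Nat.card K := Finite.one_lt_card
  rw [h.card] at h1
  by_contra! hq
  interval_cases q <;> simp at h1

theorem involutive (h : IsQuadraticFrobenius φ q) (x : K) : φ (φ x) = x := by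
  have := Fintype.ofFinite K
  rw [h.apply, h.apply, ← pow_mul, ← sq, ← h.card, Nat.card_eq_fintype_card, FiniteField.pow_card]

theorem card_units (h : IsQuadraticFrobenius φ q) : Nat.card Kˣ = (q - 1) * (q + 1) := by
  rw [Nat.card_units, h.card]
  obtain ⟨k, rfl⟩ : ∃ k, q = k + 1 := ⟨q - 1, by have := h.two_le; omega⟩
  simp only [Nat.add_sub_cancel]
  rw [show (k + 1) ^ 2 = k * (k + 1 + 1) + 1 by ring, Nat.add_sub_cancel]

/-- The norm is surjective onto the units of the fixed field: one inclusion is Lagrange, and in a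
cyclic group of order `(q - 1)(q + 1)` both subgroups have order `q - 1`. -/
theorem range_norm (h : IsQuadraticFrobenius φ q) :
    (powMonoidHom (q + 1) : Kˣ →* Kˣ).range = (powMonoidHom (q - 1) : Kˣ →* Kˣ).ker := by
  have hq := h.two_le
  refine Subgroup.eq_of_le_of_card_ge ?_ ?_
  · rintro _ ⟨x, rfl⟩
    rw [MonoidHom.mem_ker, powMonoidHom_apply, powMonoidHom_apply, ← pow_mul, mul_comm,
      ← h.card_units, pow_card_eq_one']
  · rw [IsCyclic.card_powMonoidHom_range, IsCyclic.card_powMonoidHom_ker, h.card_units,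
      Nat.gcd_mul_right_left, Nat.gcd_mul_left_left,
      Nat.mul_div_cancel _ (by omega)]

theorem map_eq_self_iff (h : IsQuadraticFrobenius φ q) (u : Kˣ) :
    φ u = u ↔ u ∈ (powMonoidHom (q - 1) : Kˣ →* Kˣ).ker := by
  have hq := h.two_le
  obtain ⟨k, rfl⟩ : ∃ k, q = k + 1 := ⟨q - 1, by omega⟩
  rw [MonoidHom.mem_ker, powMonoidHom_apply, h.apply, ← Units.val_pow_eq_pow_val, Units.val_inj,
    pow_succ, Nat.add_sub_cancel, mul_eq_right]

theorem exists_mul_map_eq (h : IsQuadraticFrobenius φ q) {c : K} (hc : c ≠ 0) (hφ : φ c = c) :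
    ∃ x : K, x ≠ 0 ∧ x * φ x = c := by
  have h1 := (h.map_eq_self_iff (Units.mk0 c hc)).1 hφ
  rw [← h.range_norm] at h1
  obtain ⟨x, hx⟩ := h1
  refine ⟨x, x.ne_zero, ?_⟩
  rw [h.apply, ← pow_succ', ← Units.val_pow_eq_pow_val, ← powMonoidHom_apply, hx, Units.val_mk0]

theorem card_fixed (h : IsQuadraticFrobenius φ q) :
    Nat.card {c : K // c ≠ 0 ∧ φ c = c} = q - 1 := by
  have e : {c : K // c ≠ 0 ∧ φ c = c} ≃ (powMonoidHom (q - 1) : Kˣ →* Kˣ).ker :=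
    { toFun := fun c => ⟨Units.mk0 c.1 c.2.1, (h.map_eq_self_iff _).1 c.2.2⟩
      invFun := fun u => ⟨u.1, u.1.ne_zero, (h.map_eq_self_iff _).2 u.2⟩
      left_inv := fun c => by simp
      right_inv := fun u => by simp }
  rw [Nat.card_congr e, IsCyclic.card_powMonoidHom_ker, h.card_units, Nat.gcd_mul_right_left]

theorem exists_map_ne (h : IsQuadraticFrobenius φ q) : ∃ c : K, φ c ≠ c := by
  by_contra! hc
  have h1 := h.card_fixed
  have e : {c : K // c ≠ 0 ∧ φ c = c} ≃ Kˣ :=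
    { toFun := fun c => Units.mk0 c.1 c.2.1
      invFun := fun u => ⟨u.1, u.ne_zero, hc _⟩
      left_inv := fun c => by simp
      right_inv := fun u => by simp }
  rw [Nat.card_congr e, h.card_units] at h1
  have hq := h.two_le
  have : 1 ≤ q - 1 := by omega
  nlinarith

end IsQuadraticFrobenius

/-! ### Hermitian forms over a field and orthonormal families -/

section Hermitian

variable {K : Type*} [Field K] {n : ℕ}

/-- The form `∑ xᵢ φ(yᵢ)` on `K ^ n`. -/
def herm (φ : K →+* K) (x y : Fin n → K) : K := ∑ i, x i * φ (y i)

/-- The form `herm φ` restricted to `W` is nondegenerate. -/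
def HermNondegenerate (φ : K →+* K) (W : Submodule K (Fin n → K)) : Prop :=
  ∀ x ∈ W, (∀ y ∈ W, herm φ x y = 0) → x = 0

/-- The family `f` is orthonormal for `herm φ`. -/
def HermOrthonormal (φ : K →+* K) {r : ℕ} (f : Fin r → Fin n → K) : Prop :=
  ∀ i j, herm φ (f i) (f j) = if i = j then 1 else 0

variable (φ : K →+* K)

theorem herm_add_left (x y z : Fin n → K) : herm φ (x + y) z = herm φ x z + herm φ y z := by
  simp [herm, add_mul, Finset.sum_add_distrib]

theorem herm_add_right (x y z : Fin n → K) : herm φ x (y + z) = herm φ x y + herm φ x z := by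
  simp [herm, mul_add, Finset.sum_add_distrib]

theorem herm_smul_left (c : K) (x y : Fin n → K) : herm φ (c • x) y = c * herm φ x y := by
  simp [herm, Finset.mul_sum, mul_assoc]

theorem herm_smul_right (c : K) (x y : Fin n → K) : herm φ x (c • y) = φ c * herm φ x y := by
  simp [herm, Finset.mul_sum, mul_left_comm]

theorem herm_zero_left (y : Fin n → K) : herm φ 0 y = 0 := by simp [herm]

theorem herm_zero_right (y : Fin n → K) : herm φ y 0 = 0 := by simp [herm]

theorem herm_neg_left (x y : Fin n → K) : herm φ (-x) y = - herm φ x y := by simp [herm]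

theorem herm_sub_left (x y z : Fin n → K) : herm φ (x - y) z = herm φ x z - herm φ y z := by
  rw [sub_eq_add_neg, herm_add_left, herm_neg_left, sub_eq_add_neg]

theorem herm_sum_left {ι : Type*} (s : Finset ι) (x : ι → Fin n → K) (y : Fin n → K) :
    herm φ (∑ i ∈ s, x i) y = ∑ i ∈ s, herm φ (x i) y := by
  classical
  induction s using Finset.induction_on with
  | empty => simp [herm_zero_left]
  | insert i s hi ih => rw [Finset.sum_insert hi, Finset.sum_insert hi, herm_add_left, ih]

theorem herm_sum_right {ι : Type*} (s : Finset ι) (x : ι → Fin n → K) (y : Fin n → K) :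
    herm φ y (∑ i ∈ s, x i) = ∑ i ∈ s, herm φ y (x i) := by
  classical
  induction s using Finset.induction_on with
  | empty => simp [herm_zero_right]
  | insert i s hi ih => rw [Finset.sum_insert hi, Finset.sum_insert hi, herm_add_right, ih]

theorem map_herm {φ : K →+* K} (hφ : ∀ x, φ (φ x) = x) (x y : Fin n → K) :
    φ (herm φ x y) = herm φ y x := by
  simp [herm, hφ, mul_comm]

namespace HermOrthonormal

variable {φ} {r : ℕ} {f : Fin r → Fin n → K}

theorem herm_sum_smul_left (hf : HermOrthonormal φ f) (c : Fin r → K) (j : Fin r) :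
    herm φ (∑ i, c i • f i) (f j) = c j := by
  simp only [herm_sum_left, herm_smul_left, hf _ _, mul_ite, mul_one, mul_zero,
    Finset.sum_ite_eq', Finset.mem_univ, if_true]

theorem herm_sum_sum (hf : HermOrthonormal φ f) (c d : Fin r → K) :
    herm φ (∑ i, c i • f i) (∑ i, d i • f i) = herm φ c d := by
  simp only [herm_sum_right, herm_smul_right, hf.herm_sum_smul_left]
  simp only [herm, mul_comm]

theorem linearIndependent (hf : HermOrthonormal φ f) : LinearIndependent K f := by
  rw [Fintype.linearIndependent_iff]
  intro c hc j
  rw [← hf.herm_sum_smul_left c j, hc, herm_zero_left]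

theorem finrank_span (hf : HermOrthonormal φ f) :
    Module.finrank K (Submodule.span K (Set.range f)) = r := by
  rw [finrank_span_eq_card hf.linearIndependent, Fintype.card_fin]

end HermOrthonormal

end Hermitian

/-! ### Counting orthonormal families in a Hermitian space -/

section HermitianCount

variable {K : Type*} [Field K] {n : ℕ} (φ : K →+* K)

/-- The linear functional `herm φ · v`. -/
def hermLeft (v : Fin n → K) : (Fin n → K) →ₗ[K] K where
  toFun x := herm φ x v
  map_add' x y := herm_add_left φ x y v
  map_smul' c x := herm_smul_left φ c x v

/-- The vectors of `W` orthogonal to `v`. -/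
def hermPerp (W : Submodule K (Fin n → K)) (v : Fin n → K) : Submodule K (Fin n → K) :=
  W ⊓ LinearMap.ker (hermLeft φ v)

variable {φ}

theorem mem_hermPerp {W : Submodule K (Fin n → K)} {v x : Fin n → K} :
    x ∈ hermPerp φ W v ↔ x ∈ W ∧ herm φ x v = 0 := Iff.rfl

theorem herm_eq_zero_symm (hφ : ∀ x, φ (φ x) = x) {x y : Fin n → K} (h : herm φ x y = 0) :
    herm φ y x = 0 := by
  rw [← map_herm hφ, h, map_zero]

/-- A unit vector splits off as an orthogonal summand. -/
def hermSplit {W : Submodule K (Fin n → K)} {v : Fin n → K} (hv : v ∈ W) (h1 : herm φ v v = 1) :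
    W ≃ₗ[K] K × hermPerp φ W v where
  toFun x := (herm φ x.1 v, ⟨x.1 - herm φ x.1 v • v, W.sub_mem x.2 (W.smul_mem _ hv), by
    change herm φ _ _ = 0
    rw [herm_sub_left, herm_smul_left, h1, mul_one, sub_self]⟩)
  invFun p := ⟨p.1 • v + p.2.1, W.add_mem (W.smul_mem _ hv) p.2.2.1⟩
  map_add' x y := by
    ext
    · simp [herm_add_left]
    · simp [herm_add_left]; ring
  map_smul' c x := by
    ext
    · simp [herm_smul_left]
    · simp [herm_smul_left]; ring
  left_inv x := by simp
  right_inv p := by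
    have h2 : herm φ p.2.1 v = 0 := p.2.2.2
    ext
    · simp [herm_add_left, herm_smul_left, h1, h2]
    · simp [herm_add_left, herm_smul_left, h1, h2]

theorem herm_hermSplit_symm (hφ : ∀ x, φ (φ x) = x) {W : Submodule K (Fin n → K)} {v : Fin n → K}
    (hv : v ∈ W) (h1 : herm φ v v = 1) (p : K × hermPerp φ W v) :
    herm φ ((hermSplit hv h1).symm p).1 ((hermSplit hv h1).symm p).1 =
      p.1 * φ p.1 + herm φ p.2.1 p.2.1 := by
  have h2 : herm φ p.2.1 v = 0 := p.2.2.2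
  have h3 : herm φ v p.2.1 = 0 := herm_eq_zero_symm hφ h2
  change herm φ (p.1 • v + p.2.1) (p.1 • v + p.2.1) = _
  simp [herm_add_left, herm_add_right, herm_smul_left, herm_smul_right, h1, h2, h3, mul_comm]

/-- A vector of the complement orthogonal to the complement is also orthogonal to `v`, hence to all
of `W`. -/
theorem HermNondegenerate.hermPerp {W : Submodule K (Fin n → K)}
    (hW : HermNondegenerate φ W) {v : Fin n → K} (hv : v ∈ W) (h1 : herm φ v v = 1) :
    HermNondegenerate φ (hermPerp φ W v) := by
  intro x hx h
  refine hW x hx.1 fun y hy => ?_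
  have h2 := h _ ((hermSplit hv h1) ⟨y, hy⟩).2.2
  have h3 : y = herm φ y v • v + ((hermSplit hv h1) ⟨y, hy⟩).2.1 := by
    change y = herm φ y v • v + (y - herm φ y v • v)
    simp
  rw [h3, herm_add_right, herm_smul_right, h2, mem_hermPerp.1 hx |>.2, mul_zero, add_zero]

variable [Finite K]

omit [Finite K] in
theorem finrank_hermPerp {W : Submodule K (Fin n → K)} {v : Fin n → K}
    (hv : v ∈ W) (h1 : herm φ v v = 1) :
    Module.finrank K W = Module.finrank K (hermPerp φ W v) + 1 := by
  rw [(hermSplit hv h1).finrank_eq, Module.finrank_prod, Module.finrank_self, add_comm]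

variable {q : ℕ}

theorem HermNondegenerate.exists_unit (hq : IsQuadraticFrobenius φ q)
    {W : Submodule K (Fin n → K)} (hW : HermNondegenerate φ W) (hne : W ≠ ⊥) :
    ∃ v ∈ W, herm φ v v = 1 := by
  obtain ⟨x, hx, hx0⟩ : ∃ x ∈ W, herm φ x x ≠ 0 := by
    by_contra! h
    -- Polarisation: if every vector is isotropic, expanding at `x + y` and at `x + c • y` with `φ c
    -- ≠ c` forces `herm φ x y = 0`.
    refine hne ((Submodule.eq_bot_iff _).2 fun x hx => hW x hx fun y hy => ?_)
    obtain ⟨c, hc⟩ := hq.exists_map_ne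
    have h1 := h _ (W.add_mem hx hy)
    have h2 := h _ (W.add_mem hx (W.smul_mem c hy))
    simp only [herm_add_left, herm_add_right, herm_smul_left, herm_smul_right, h x hx, h y hy] at h1 h2
    have h3 : (φ c - c) * herm φ x y = 0 := by linear_combination h2 - c * h1
    exact (mul_eq_zero.1 h3).resolve_left (sub_ne_zero.2 hc)
  have h1 : φ (herm φ x x)⁻¹ = (herm φ x x)⁻¹ := by rw [map_inv₀, map_herm hq.involutive]
  obtain ⟨c, -, hc⟩ := hq.exists_mul_map_eq (inv_ne_zero hx0) h1
  refine ⟨c • x, W.smul_mem _ hx, ?_⟩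
  rw [herm_smul_left, herm_smul_right, ← mul_assoc, hc, inv_mul_cancel₀ hx0]

/-- Scaling by an element of norm `c` carries unit vectors bijectively to vectors of value `c`. -/
theorem card_herm_self_eq (hq : IsQuadraticFrobenius φ q) (W : Submodule K (Fin n → K)) {c : K}
    (hc : c ≠ 0) (hφ : φ c = c) :
    Nat.card {x : W // herm φ x.1 x.1 = c} = Nat.card {x : W // herm φ x.1 x.1 = 1} := by
  obtain ⟨d, hd0, hd⟩ := hq.exists_mul_map_eq hc hφ
  refine (Nat.card_congr ((LinearEquiv.smulOfUnit (Units.mk0 d hd0) : W ≃ₗ[K] W).toEquiv.subtypeEquiv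
    fun x => ?_)).symm
  change herm φ x.1 x.1 = 1 ↔ herm φ (d • x.1) (d • x.1) = c
  rw [herm_smul_left, herm_smul_right, ← mul_assoc, hd, mul_eq_left₀ hc]

/-- Partition `W` by the value `herm φ x x`: values not fixed by `φ` are never attained, and the `q
- 1` nonzero fixed ones have fibres of equal size. -/
theorem card_eq_isotropic_add (hq : IsQuadraticFrobenius φ q) (W : Submodule K (Fin n → K)) :
    q ^ (2 * Module.finrank K W) = Nat.card {x : W // herm φ x.1 x.1 = 0} +
      (q - 1) * Nat.card {x : W // herm φ x.1 x.1 = 1} := by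
  classical
  have := Fintype.ofFinite K
  rw [pow_mul, ← hq.card, ← Module.natCard_eq_pow_finrank,
    ← Nat.card_congr (Equiv.sigmaFiberEquiv fun x : W => herm φ x.1 x.1), Nat.card_sigma,
    ← Finset.add_sum_erase _ _ (Finset.mem_univ (0 : K)), ← hq.card_fixed]
  congr 1
  rw [Nat.card_eq_fintype_card, Fintype.card_subtype, ← smul_eq_mul, ← Finset.sum_const]
  symm
  refine Finset.sum_subset_zero_on_sdiff (fun c hc => ?_) (fun c hc => ?_) (fun c hc => ?_)
  · simpa using (Finset.mem_filter.1 hc).2.1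
  · simp only [Finset.mem_sdiff, Finset.mem_erase, Finset.mem_filter, Finset.mem_univ, and_true,
      true_and, not_and] at hc
    have : IsEmpty {x : W // herm φ x.1 x.1 = c} :=
      ⟨fun x => hc.2 hc.1 (by rw [← x.2, map_herm hq.involutive])⟩
    exact Nat.card_of_isEmpty
  · rw [Finset.mem_filter] at hc
    exact (card_herm_self_eq hq W hc.2.1 hc.2.2).symm

/-- With `x = t • v + y`, isotropy of `x` means that `y` has value `-(t * φ t)`. The term `t = 0`
leaves isotropic `y`; each of the other `q ^ 2 - 1` values of `t` gives as many `y` as there are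
unit vectors. -/
theorem card_isotropic_succ (hq : IsQuadraticFrobenius φ q) {W : Submodule K (Fin n → K)}
    {v : Fin n → K} (hv : v ∈ W) (h1 : herm φ v v = 1) :
    Nat.card {x : W // herm φ x.1 x.1 = 0} =
      Nat.card {x : hermPerp φ W v // herm φ x.1 x.1 = 0} +
        (q ^ 2 - 1) * Nat.card {x : hermPerp φ W v // herm φ x.1 x.1 = 1} := by
  classical
  have := Fintype.ofFinite K
  have e : {x : W // herm φ x.1 x.1 = 0} ≃
      Σ t : K, {x : hermPerp φ W v // herm φ x.1 x.1 = -(t * φ t)} :=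
    ((hermSplit hv h1).toEquiv.subtypeEquiv
      (q := fun p : K × hermPerp φ W v => herm φ p.2.1 p.2.1 = -(p.1 * φ p.1)) fun x => by
      rw [eq_neg_iff_add_eq_zero, add_comm, LinearEquiv.coe_toEquiv,
        ← herm_hermSplit_symm hq.involutive hv h1, LinearEquiv.symm_apply_apply]).trans
      (Equiv.subtypeProdEquivSigmaSubtype fun t (x : hermPerp φ W v) =>
        herm φ x.1 x.1 = -(t * φ t))
  rw [Nat.card_congr e, Nat.card_sigma, ← Finset.add_sum_erase _ _ (Finset.mem_univ (0 : K))]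
  congr 1
  · simp
  · rw [← hq.card, Nat.card_eq_fintype_card, ← Finset.card_univ,
      ← Finset.card_erase_of_mem (Finset.mem_univ (0 : K)), ← smul_eq_mul, ← Finset.sum_const]
    refine Finset.sum_congr rfl fun t ht => card_herm_self_eq hq _ ?_ ?_
    · have ht0 : t ≠ 0 := (Finset.mem_erase.1 ht).1
      exact neg_ne_zero.2 (mul_ne_zero ht0 ((map_ne_zero φ).2 ht0))
    · rw [map_neg, map_mul, hq.involutive, mul_comm]

/-- Induction on dimension: the two preceding relations determine the count in `W` from that in the
complement of a unit vector. The factor `q` on the left avoids a division. -/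
theorem card_isotropic (hq : IsQuadraticFrobenius φ q) (m : ℕ) (W : Submodule K (Fin n → K))
    (hW : HermNondegenerate φ W) (hm : Module.finrank K W = m) :
    (q : ℤ) * Nat.card {x : W // herm φ x.1 x.1 = 0} =
      (q : ℤ) ^ (2 * m) + (-1) ^ m * (q - 1) * (q : ℤ) ^ m := by
  induction m generalizing W with
  | zero =>
    have h0 : W = ⊥ := Submodule.finrank_eq_zero.1 hm
    subst h0
    have : Unique {x : (⊥ : Submodule K (Fin n → K)) // herm φ x.1 x.1 = 0} :=
      { default := ⟨0, herm_zero_left φ _⟩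
        uniq := fun x => Subtype.ext (Subsingleton.elim _ _) }
    rw [Nat.card_unique]
    push_cast
    ring
  | succ m ih =>
    obtain ⟨v, hv, h1⟩ := hW.exists_unit hq (by rintro rfl; simp at hm)
    have hd := finrank_hermPerp hv h1
    have hm' : Module.finrank K (hermPerp φ W v) = m := by omega
    have h2 := ih _ (hW.hermPerp hv h1) hm'
    have h3 := card_eq_isotropic_add hq (hermPerp φ W v)
    have h4 := card_isotropic_succ hq hv h1
    rw [hm'] at h3
    have hq2 := hq.two_le
    zify [show 1 ≤ q by omega, show 1 ≤ q ^ 2 from Nat.one_le_pow _ _ (by omega)] at h3 h4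
    rw [h4]
    ring_nf at h2 h3 ⊢
    linear_combination (-(q : ℤ)) * h2 - ((q : ℤ) ^ 2 + q) * h3

/-- The number of unit vectors in a nondegenerate Hermitian space of dimension `m` over a field
with `q ^ 2` elements. -/
def hermUnitCount (q m : ℕ) : ℚ := (q : ℚ) ^ (m - 1) * ((q : ℚ) ^ m - (-1) ^ m)

theorem card_unit (hq : IsQuadraticFrobenius φ q) {m : ℕ} {W : Submodule K (Fin n → K)}
    (hW : HermNondegenerate φ W) (hm : Module.finrank K W = m) (hm0 : 0 < m) :
    (Nat.card {x : W // herm φ x.1 x.1 = 1} : ℚ) = hermUnitCount q m := by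
  obtain ⟨k, rfl⟩ : ∃ k, m = k + 1 := ⟨m - 1, by omega⟩
  have h1 := card_isotropic hq _ W hW hm
  have h2 := card_eq_isotropic_add hq W
  have hq2 := hq.two_le
  rw [hm] at h2
  zify [show 1 ≤ q by omega] at h2
  have h1' := congrArg (Int.cast : ℤ → ℚ) h1
  have h2' := congrArg (Int.cast : ℤ → ℚ) h2
  push_cast at h1' h2'
  have hq0 : (q : ℚ) ≠ 0 := by positivity
  have hq1 : (q : ℚ) - 1 ≠ 0 := by
    have : (2 : ℚ) ≤ q := by exact_mod_cast hq2
    linarith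
  have : (q : ℚ) * ((q : ℚ) - 1) ≠ 0 := mul_ne_zero hq0 hq1
  apply mul_left_cancel₀ this
  rw [hermUnitCount, Nat.add_sub_cancel]
  ring_nf at h1' h2' ⊢
  linear_combination (-(q : ℚ)) * h2' - h1'

/-- The orthonormal families of length `r` in `W`. -/
def HermFrames (φ : K →+* K) (W : Submodule K (Fin n → K)) (r : ℕ) : Type _ :=
  {f : Fin r → Fin n → K // (∀ i, f i ∈ W) ∧ HermOrthonormal φ f}

instance (W : Submodule K (Fin n → K)) (r : ℕ) : Finite (HermFrames φ W r) :=
  inferInstanceAs (Finite {f : Fin r → Fin n → K // (∀ i, f i ∈ W) ∧ HermOrthonormal φ f})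

omit [Finite K] in
theorem hermOrthonormal_cons_iff (hφ : ∀ x, φ (φ x) = x) {r : ℕ} {v : Fin n → K}
    {f : Fin r → Fin n → K} :
    HermOrthonormal φ (Fin.cons v f : Fin (r + 1) → Fin n → K) ↔
      herm φ v v = 1 ∧ (∀ i, herm φ (f i) v = 0) ∧ HermOrthonormal φ f := by
  simp only [HermOrthonormal, Fin.forall_fin_succ, Fin.cons_zero, Fin.cons_succ, if_true,
    Fin.succ_inj, (Fin.succ_ne_zero _), (Fin.succ_ne_zero _).symm, if_false]
  constructor
  · rintro ⟨⟨h1, -⟩, h3⟩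
    exact ⟨h1, fun i => (h3 i).1, fun i => (h3 i).2⟩
  · rintro ⟨h1, h2, h3⟩
    exact ⟨⟨h1, fun i => herm_eq_zero_symm hφ (h2 i)⟩, fun i => ⟨h2 i, h3 i⟩⟩

/-- An orthonormal family is a unit vector and an orthonormal family in its complement. -/
def hermFramesSucc (hφ : ∀ x, φ (φ x) = x) (W : Submodule K (Fin n → K)) (r : ℕ) :
    HermFrames φ W (r + 1) ≃
      Σ v : {x : W // herm φ x.1 x.1 = 1}, HermFrames φ (hermPerp φ W v.1.1) r where
  toFun f :=
    have h : HermOrthonormal φ (Fin.cons (f.1 0) (Fin.tail f.1) : Fin (r + 1) → Fin n → K) := by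
      rw [Fin.cons_self_tail]; exact f.2.2
    ⟨⟨⟨f.1 0, f.2.1 0⟩, ((hermOrthonormal_cons_iff hφ).1 h).1⟩,
      ⟨Fin.tail f.1, fun i => ⟨f.2.1 i.succ, ((hermOrthonormal_cons_iff hφ).1 h).2.1 i⟩,
        ((hermOrthonormal_cons_iff hφ).1 h).2.2⟩⟩
  invFun p := ⟨Fin.cons p.1.1.1 p.2.1,
    Fin.cases p.1.1.2 fun i => (p.2.2.1 i).1,
    (hermOrthonormal_cons_iff hφ).2 ⟨p.1.2, fun i => (p.2.2.1 i).2, p.2.2.2⟩⟩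
  left_inv f := Subtype.ext (Fin.cons_self_tail f.1)
  right_inv p := rfl

/-- The number of orthonormal families of length `r` in a nondegenerate Hermitian space of
dimension `m`. -/
def hermFrameCount (q m r : ℕ) : ℚ := ∏ i ∈ Finset.range r, hermUnitCount q (m - i)

theorem card_hermFrames (hq : IsQuadraticFrobenius φ q) {m r : ℕ} {W : Submodule K (Fin n → K)}
    (hW : HermNondegenerate φ W) (hm : Module.finrank K W = m) (hr : r ≤ m) :
    (Nat.card (HermFrames φ W r) : ℚ) = hermFrameCount q m r := by
  induction r generalizing m W with
  | zero =>
    have : Unique (HermFrames φ W 0) :=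
      { default := ⟨Fin.elim0, fun i => i.elim0, fun i => i.elim0⟩
        uniq := fun f => Subtype.ext (funext fun i => i.elim0) }
    simp [hermFrameCount]
  | succ r ih =>
    have := Fintype.ofFinite {x : W // herm φ x.1 x.1 = 1}
    rw [Nat.card_congr (hermFramesSucc hq.involutive W r), Nat.card_sigma, Nat.cast_sum,
      Finset.sum_congr rfl fun v _ => ih (hW.hermPerp v.1.2 v.2) (m := m - 1)
        (by have := finrank_hermPerp v.1.2 v.2; omega) (by omega),
      Finset.sum_const, Finset.card_univ, ← Nat.card_eq_fintype_card, nsmul_eq_mul,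
      card_unit hq hW hm (by omega), hermFrameCount, hermFrameCount, Finset.prod_range_succ',
      mul_comm, Nat.sub_zero]
    congr 1
    exact Finset.prod_congr rfl fun i _ => by rw [Nat.sub_sub, add_comm 1]

theorem hermUnitCount_pos (hq : 2 ≤ q) {m : ℕ} (hm : 0 < m) : 0 < hermUnitCount q m := by
  have h2 : (1 : ℚ) < q := by exact_mod_cast hq
  refine mul_pos (by positivity) (sub_pos.2 ?_)
  have h3 : (1 : ℚ) < (q : ℚ) ^ m := one_lt_pow₀ h2 hm.ne'
  rcases neg_one_pow_eq_or ℚ m with h | h <;> rw [h] <;> linarith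

theorem hermFrameCount_pos (hq : 2 ≤ q) {m r : ℕ} (hr : r ≤ m) : 0 < hermFrameCount q m r :=
  Finset.prod_pos fun i hi => hermUnitCount_pos hq (by have := Finset.mem_range.1 hi; omega)

/-- This identifies `M(m, r)` as orthonormal `r`-families in dimension `m` divided by orthonormal
bases in dimension `r`, the form in which it enters the final quotient. -/
theorem hermitianCount_mul (hq : 2 ≤ q) {m r : ℕ} (hr : r ≤ m) :
    hermitianCount q m r * hermFrameCount q r r = hermFrameCount q m r := by
  have h1 : (q : ℚ) ^ (r * (m - r)) = ∏ i ∈ Finset.range r, (q : ℚ) ^ (m - r) := by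
    rw [Finset.prod_const, Finset.card_range, ← pow_mul, mul_comm]
  rw [hermitianCount, h1, hermFrameCount, hermFrameCount, ← Finset.prod_mul_distrib,
    ← Finset.prod_mul_distrib]
  refine Finset.prod_congr rfl fun i hi => ?_
  have hir := Finset.mem_range.1 hi
  have h2 := (hermUnitCount_pos hq (show 0 < r - i by omega)).ne'
  rw [hermUnitCount] at h2
  rw [hermUnitCount, hermUnitCount, show m - i - 1 = (m - r) + (r - i - 1) by omega, pow_add]
  field_simp [right_ne_zero_of_mul h2]

theorem HermNondegenerate.exists_frame (hq : IsQuadraticFrobenius φ q)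
    {W : Submodule K (Fin n → K)} (hW : HermNondegenerate φ W) :
    ∃ f : Fin (Module.finrank K W) → Fin n → K, HermOrthonormal φ f ∧
      Submodule.span K (Set.range f) = W := by
  have h1 := card_hermFrames hq hW rfl le_rfl
  -- An orthonormal basis exists because the number of them is positive.
  have h2 := hermFrameCount_pos hq.two_le (le_refl (Module.finrank K W))
  rw [← h1, Nat.cast_pos] at h2
  obtain ⟨f, hfW, hf⟩ := (Nat.card_pos_iff.1 h2).1.some
  refine ⟨f, hf, Submodule.eq_of_le_of_finrank_eq ?_ hf.finrank_span⟩
  rw [Submodule.span_le]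
  rintro _ ⟨i, rfl⟩
  exact hfW i

end HermitianCount

/-! ### Reduction of the Galois group to the residue field -/

section GaloisExtension

theorem AdjoinRoot.natCard {k : Type*} [Field k] [Finite k] {g : k[X]} (hg : g ≠ 0) :
    Nat.card (AdjoinRoot g) = Nat.card k ^ g.natDegree := by
  have := (AdjoinRoot.powerBasis hg).finite
  rw [Module.natCard_eq_pow_finrank (K := k), (AdjoinRoot.powerBasis hg).finrank,
    AdjoinRoot.powerBasis_dim]

open IsLocalRing

theorem IsLocalRing.isNilpotent_of_residue_eq_zero {R : Type*} [CommRing R] [Finite R]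
    [IsLocalRing R] {x : R} (hx : residue R x = 0) : IsNilpotent x := by
  obtain ⟨n, hn⟩ := IsArtinianRing.isNilpotent_jacobson_bot (R := R)
  rw [jacobson_eq_maximalIdeal ⊥ bot_ne_top] at hn
  refine ⟨n, ?_⟩
  have := Ideal.pow_mem_pow ((residue_eq_zero_iff x).1 hx) n
  rwa [hn] at this

variable {S R : Type*} [CommRing S] [IsLocalRing S] [CommRing R] [IsLocalRing R] [Algebra S R]

omit [IsLocalRing S] in
theorem aeval_residue (f : S[X]) (x : R) : aeval (residue R x) f = residue R (aeval x f) :=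
  aeval_algebraMap_apply (ResidueField R) x f

theorem aeval_map_residue [IsLocalHom (algebraMap S R)] (f : S[X]) (x : ResidueField R) :
    aeval x (f.map (residue S)) = aeval x f := by
  rw [← ResidueField.algebraMap_eq, aeval_map_algebraMap]

/-- Hensel lifting: the maximal ideal is nilpotent, and separability makes the derivative a unit at
any lift of the root. -/
theorem existsUnique_lift_root [Finite R] [IsLocalHom (algebraMap S R)] {f : S[X]}
    (hf : (f.map (residue S)).Separable) {x : ResidueField R}
    (hx : aeval x (f.map (residue S)) = 0) : ∃! r : R, residue R r = x ∧ aeval r f = 0 := by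
  obtain ⟨y, rfl⟩ := residue_surjective x
  have h1 : IsNilpotent (aeval y f) := isNilpotent_of_residue_eq_zero (by
    rw [← aeval_residue, ← aeval_map_residue, hx])
  have h2 : IsUnit (aeval y (derivative f)) := by
    rw [← residue_ne_zero_iff_isUnit, ← aeval_residue, ← aeval_map_residue, ← derivative_map]
    exact hf.aeval_derivative_ne_zero hx
  have h3 (r : R) : residue R r = residue R y ↔ IsNilpotent (y - r) := by
    rw [eq_comm, ← sub_eq_zero, ← map_sub]
    exact ⟨isNilpotent_of_residue_eq_zero, fun h => (h.map (residue R)).eq_zero⟩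
  simpa only [h3] using existsUnique_nilpotent_sub_and_aeval_eq_zero h1 h2

section

variable {f : S[X]} (hf : Irreducible (f.map (residue S))) (ε : R ≃ₐ[S] AdjoinRoot f)

/-- The reduction of `S[x]/⟨f⟩` to the residue field of `S`. -/
noncomputable def adjoinRootReduction (ε : R ≃ₐ[S] AdjoinRoot f) :
    R →+* AdjoinRoot (f.map (residue S)) :=
  (AdjoinRoot.map (residue S) f (f.map (residue S)) dvd_rfl).comp (ε : R →+* AdjoinRoot f)

omit [IsLocalRing R] in
theorem adjoinRootReduction_algebraMap (s : S) :
    adjoinRootReduction ε (algebraMap S R s) = algebraMap _ _ (residue S s) := by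
  simp [adjoinRootReduction, AdjoinRoot.algebraMap_eq]

omit [IsLocalRing R] in
theorem adjoinRootReduction_surjective : Function.Surjective (adjoinRootReduction ε) := by
  intro y
  obtain ⟨p, rfl⟩ := AdjoinRoot.mk_surjective y
  obtain ⟨g, rfl⟩ := Polynomial.map_surjective (residue S) residue_surjective p
  refine ⟨ε.symm (AdjoinRoot.mk f g), ?_⟩
  simp only [adjoinRootReduction, RingHom.comp_apply, RingHom.coe_coe, AlgEquiv.apply_symm_apply]
  rw [AdjoinRoot.map, AdjoinRoot.lift_mk, ← AdjoinRoot.aeval_eq, aeval_def, eval₂_map,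
    AdjoinRoot.algebraMap_eq]

include hf ε

omit [IsLocalRing R] in
theorem isLocalHom_algebraMap : IsLocalHom (algebraMap S R) := by
  have := Fact.mk hf
  refine ⟨fun s hs => ?_⟩
  rw [← residue_ne_zero_iff_isUnit]
  intro h
  have h1 := hs.map (adjoinRootReduction ε)
  rw [adjoinRootReduction_algebraMap, h, map_zero] at h1
  exact not_isUnit_zero h1

theorem finrank_residueField [Finite S] [Finite R] [IsLocalHom (algebraMap S R)]
    (hmonic : f.Monic) :
    Module.finrank (ResidueField S) (ResidueField R) = f.natDegree := by
  have := Fact.mk hf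
  have : Finite (ResidueField S) := Finite.of_surjective _ residue_surjective
  have : Finite (ResidueField R) := Finite.of_surjective _ residue_surjective
  have hsurj := adjoinRootReduction_surjective ε
  have hker : RingHom.ker (adjoinRootReduction ε) = maximalIdeal R :=
    eq_maximalIdeal (RingHom.ker_isMaximal_of_surjective _ hsurj)
  have hcard : Nat.card (ResidueField R) = Nat.card (AdjoinRoot (f.map (residue S))) := by
    rw [← Nat.card_congr (RingHom.quotientKerEquivOfSurjective hsurj).toEquiv, hker]
    rfl
  rw [Module.natCard_eq_pow_finrank (K := ResidueField S), AdjoinRoot.natCard hf.ne_zero,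
    hmonic.natDegree_map] at hcard
  exact Nat.pow_right_injective (Finite.one_lt_card (α := ResidueField S)) hcard

omit hf [IsLocalRing S] [IsLocalRing R] in
theorem algHom_ext_of_root {A : Type*} [CommRing A] [Algebra S A] {g₁ g₂ : R →ₐ[S] A}
    (h : g₁ (ε.symm (AdjoinRoot.root f)) = g₂ (ε.symm (AdjoinRoot.root f))) : g₁ = g₂ := by
  have h1 : g₁.comp (ε.symm : AdjoinRoot f →ₐ[S] R) = g₂.comp (ε.symm : AdjoinRoot f →ₐ[S] R) :=
    AdjoinRoot.algHom_ext h
  ext x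
  simpa using DFunLike.congr_fun h1 (ε x)

/-- `R` is generated by a root `α` of `f`. The Frobenius image of its residue lifts to a root `β` of
`f`, and `α ↦ β` defines the lift. It is needed to see that `σ` reduces to a generator of the
residue Galois group. -/
theorem exists_lift_frobenius [Finite R] [Fintype (ResidueField S)]
    [IsLocalHom (algebraMap S R)] :
    ∃ Φ : R ≃ₐ[S] R, ∀ x, residue R (Φ x) = residue R x ^ Fintype.card (ResidueField S) := by
  have : Finite (ResidueField R) := Finite.of_surjective _ residue_surjective
  have := Fintype.ofFinite (ResidueField R)
  have hsep : (f.map (residue S)).Separable := PerfectField.separable_of_irreducible hf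
  set α : R := ε.symm (AdjoinRoot.root f) with hα
  have hαf : aeval α f = 0 := by
    rw [hα, ← AlgEquiv.coe_toAlgHom, aeval_algHom_apply, AdjoinRoot.aeval_eq, AdjoinRoot.mk_self,
      map_zero]
  have hα' : aeval (residue R α) (f.map (residue S)) = 0 := by
    rw [aeval_map_residue, aeval_residue, hαf, map_zero]
  obtain ⟨β, ⟨hβ1, hβ2⟩, -⟩ := existsUnique_lift_root (R := R) hsep
    (x := residue R α ^ Fintype.card (ResidueField S)) (by
      rw [← FiniteField.frobeniusAlgHom_apply, aeval_algHom_apply, hα', map_zero])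
  let φ : R →ₐ[S] R := (AdjoinRoot.liftAlgHom f (Algebra.ofId S R) β hβ2).comp
    (ε : R →ₐ[S] AdjoinRoot f)
  have hφα : φ α = β := by
    simpa [φ, hα] using AdjoinRoot.liftAlgHom_root f (Algebra.ofId S R) β hβ2
  have hφ (x : R) : residue R (φ x) = residue R x ^ Fintype.card (ResidueField S) := by
    have h1 : (IsScalarTower.toAlgHom S R (ResidueField R)).comp φ =
        ((FiniteField.frobeniusAlgHom (ResidueField S) (ResidueField R)).restrictScalars S).comp
          (IsScalarTower.toAlgHom S R (ResidueField R)) := by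
      refine algHom_ext_of_root ε ?_
      change residue R (φ α) = residue R α ^ _
      rw [hφα, hβ1]
    exact DFunLike.congr_fun h1 x
  have hpow (n : ℕ) (x : R) :
      residue R ((φ ^ n) x) = residue R x ^ Fintype.card (ResidueField S) ^ n := by
    induction n generalizing x with
    | zero => simp
    | succ n ih => rw [pow_succ, AlgHom.mul_apply, ih, hφ, ← pow_mul, pow_succ']
  -- For `n` the residue degree, `φ ^ n` sends `α` to a root of `f` with the same residue as `α`,
  -- hence to `α` by uniqueness of lifts.
  obtain ⟨n, hn, hφn⟩ : ∃ n, 0 < n ∧ φ ^ n = 1 := by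
    refine ⟨_, Module.finrank_pos (R := ResidueField S) (M := ResidueField R),
      algHom_ext_of_root ε ?_⟩
    refine (existsUnique_lift_root hsep hα').unique ⟨?_, ?_⟩ ⟨rfl, hαf⟩
    · rw [← hα, hpow, ← Module.card_eq_pow_finrank, FiniteField.pow_card]
    · rw [aeval_algHom_apply, ← hα, hαf, map_zero]
  have hinj : Function.Injective φ := by
    intro x y h
    have h1 := DFunLike.congr_fun hφn x
    have h2 := DFunLike.congr_fun hφn y
    obtain ⟨k, rfl⟩ : ∃ k, n = k + 1 := ⟨n - 1, by omega⟩
    rw [pow_succ, AlgHom.mul_apply] at h1 h2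
    rw [h, h2] at h1
    exact h1.symm
  exact ⟨AlgEquiv.ofBijective φ (Finite.injective_iff_bijective.1 hinj), hφ⟩

end

/-- Reduction of automorphisms to the residue field. -/
noncomputable def residueAut [IsLocalHom (algebraMap S R)] :
    (R ≃ₐ[S] R) →* (ResidueField R ≃ₐ[ResidueField S] ResidueField R) where
  toFun := ResidueField.mapAlgEquiv'
  map_one' := by
    ext x
    obtain ⟨x, rfl⟩ := residue_surjective x
    rfl
  map_mul' g h := by
    ext x
    obtain ⟨x, rfl⟩ := residue_surjective x
    rfl

theorem exists_isQuadraticFrobenius [Finite S] [Finite R] {w : ℕ} (hw : 2 ≤ w) (hw_even : Even w)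
    (hSR : IsGaloisExtensionOfDegree S R w) (σ : R ≃ₐ[S] R)
    (hσ : ∀ τ : R ≃ₐ[S] R, τ ∈ Subgroup.zpowers σ) :
    ∃ (q : ℕ) (φ : ResidueField R →+* ResidueField R), IsPrimePow q ∧ IsQuadraticFrobenius φ q ∧
      ∀ x, residue R ((σ ^ (w / 2) : R ≃ₐ[S] R) x) = φ (residue R x) := by
  obtain ⟨f, hmonic, rfl, hf, ⟨ε⟩⟩ := hSR
  have := isLocalHom_algebraMap hf ε
  have : Finite (ResidueField S) := Finite.of_surjective _ residue_surjective
  have : Finite (ResidueField R) := Finite.of_surjective _ residue_surjective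
  have := Fintype.ofFinite (ResidueField R)
  have := Fintype.ofFinite (ResidueField S)
  have hrank := finrank_residueField hf ε hmonic
  obtain ⟨m, hm⟩ := hw_even.two_dvd
  set F := FiniteField.frobeniusAlgEquivOfAlgebraic (ResidueField S) (ResidueField R) with hF
  have hFord : orderOf F = f.natDegree := by
    rw [hF, FiniteField.orderOf_frobeniusAlgEquivOfAlgebraic, hrank]
  have hσord : orderOf (residueAut σ) = f.natDegree := by
    apply Nat.dvd_antisymm
    · rw [← hrank, ← IsGalois.card_aut_eq_finrank]
      exact orderOf_dvd_natCard _
    -- The lifted Frobenius is a power of `σ`, so the residue Frobenius, of order `w`, is a power of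
    -- the reduction of `σ`.
    · obtain ⟨Φ, hΦ⟩ := exists_lift_frobenius hf ε
      obtain ⟨j, rfl⟩ := Subgroup.mem_zpowers_iff.1 (hσ Φ)
      have h1 : residueAut σ ^ j = F := by
        rw [← map_zpow]
        ext x
        obtain ⟨x, rfl⟩ := residue_surjective x
        exact hΦ x
      rw [← hFord, ← h1]
      exact orderOf_dvd_of_mem_zpowers ⟨j, rfl⟩
  obtain ⟨⟨n, hn⟩, hFn⟩ := (FiniteField.bijective_frobeniusAlgEquivOfAlgebraic_pow
    (ResidueField S) (ResidueField R)).2 (residueAut σ ^ m)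
  change F ^ n = _ at hFn
  -- The reduction of `σ ^ m` is an involution, so `w = 2 * m` divides `2 * n`; with `0 < n < w`
  -- only `n = m` is left.
  have hnm : n = m := by
    have h1 : f.natDegree ∣ 2 * n := by
      rw [← hFord]
      apply orderOf_dvd_of_pow_eq_one
      rw [mul_comm, pow_mul, hFn, ← pow_mul, mul_comm m, ← hm, ← hσord, pow_orderOf_eq_one]
    have h2 : n ≠ 0 := by
      rintro rfl
      have h3 := orderOf_dvd_of_pow_eq_one hFn.symm
      rw [hσord] at h3
      have := Nat.le_of_dvd (by omega) h3
      omega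
    rw [hrank] at hn
    obtain ⟨c, hc⟩ := h1
    have : c < 2 := by
      by_contra! h
      nlinarith
    interval_cases c <;> omega
  subst hnm
  have hw2 : f.natDegree / 2 = n := by omega
  refine ⟨Fintype.card (ResidueField S) ^ n, ((residueAut (σ ^ n)).toRingEquiv : ResidueField R →+* ResidueField R),
    ?_, ⟨?_, ?_⟩, ?_⟩
  · exact (FiniteField.isPrimePow_card _).pow (by omega)
  · rw [Module.natCard_eq_pow_finrank (K := ResidueField S), hrank, hm, Nat.card_eq_fintype_card,
      mul_comm, pow_mul]
  · intro x
    change residueAut (σ ^ n) x = _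
    rw [map_pow, ← hFn, AlgEquiv.coe_pow, hF,
      FiniteField.coe_frobeniusAlgEquivOfAlgebraic_iterate]
  · intro x
    rw [hw2]
    rfl

end GaloisExtension

/-! ### Divisibility by powers of the uniformiser, and cardinalities -/

section ChainRing

open IsLocalRing

/-- `γ` generates the maximal ideal of the local ring `R`, its nilpotency index is `e`, and
`0 < s < e`. -/
structure IsChainGenerator {R : Type*} [CommRing R] [IsLocalRing R] (γ : R) (e s : ℕ) : Prop where
  maximalIdeal_eq : maximalIdeal R = Ideal.span {γ}
  pow_eq_zero : γ ^ e = 0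
  pow_ne_zero : ∀ i < e, γ ^ i ≠ 0
  pos : 0 < s
  lt : s < e

namespace IsChainGenerator

variable {R : Type*} [CommRing R] [IsLocalRing R] {γ : R} {e s : ℕ}

theorem residue_eq_zero_iff (H : IsChainGenerator γ e s) {r : R} : residue R r = 0 ↔ γ ∣ r := by
  rw [IsLocalRing.residue_eq_zero_iff, H.maximalIdeal_eq, Ideal.mem_span_singleton]

theorem isUnit_of_not_dvd (H : IsChainGenerator γ e s) {r : R} (h : ¬ γ ∣ r) : IsUnit r := by
  rwa [← residue_ne_zero_iff_isUnit, Ne, H.residue_eq_zero_iff]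

/-- Cancellation of powers of `γ` below the nilpotency index. If `r = γ ^ k * t` with `t` a unit and
`k < j - i`, the hypothesis becomes `γ ^ (i + k)` times a unit equal to `0`, although `i + k < e`.
-/
theorem pow_dvd_of_pow_mul (H : IsChainGenerator γ e s) {i j : ℕ} (hj : j ≤ e) {r : R}
    (h : γ ^ j ∣ γ ^ i * r) : γ ^ (j - i) ∣ r := by
  suffices ∀ k ≤ j - i, γ ^ k ∣ r from this _ le_rfl
  intro k
  induction k with
  | zero => simp
  | succ k ih =>
    intro hk
    obtain ⟨t, rfl⟩ := ih (by omega)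
    by_cases ht : γ ∣ t
    · rw [pow_succ]
      exact mul_dvd_mul_left _ ht
    · exfalso
      obtain ⟨u, rfl⟩ := H.isUnit_of_not_dvd ht
      obtain ⟨y, hy⟩ := h
      have h1 : IsUnit ((u : R) - γ ^ (j - i - k) * y) := by
        apply H.isUnit_of_not_dvd
        intro h2
        apply ht
        have h3 : γ ∣ γ ^ (j - i - k) * y := (dvd_pow_self γ (by omega)).mul_right y
        exact (dvd_sub_left h3).1 h2
      refine H.pow_ne_zero (i + k) (by omega) ((h1.mul_left_eq_zero).1 ?_)
      have h4 : γ ^ j = γ ^ (i + k) * γ ^ (j - i - k) := by rw [← pow_add]; congr 1; omega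
      rw [h4] at hy
      rw [pow_add] at hy ⊢
      linear_combination hy

theorem pow_dvd_of_mul_eq_zero (H : IsChainGenerator γ e s) {i : ℕ} {r : R}
    (h : γ ^ i * r = 0) : γ ^ (e - i) ∣ r :=
  H.pow_dvd_of_pow_mul le_rfl (h ▸ dvd_zero _)

theorem pow_eq_zero_of_le (H : IsChainGenerator γ e s) {i : ℕ} (h : e ≤ i) : γ ^ i = 0 :=
  _root_.pow_eq_zero_of_le h H.pow_eq_zero

theorem pow_pred_mul_eq_zero_iff (H : IsChainGenerator γ e s) {r : R} :
    γ ^ (e - 1) * r = 0 ↔ residue R r = 0 := by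
  have := H.lt
  rw [H.residue_eq_zero_iff]
  refine ⟨fun h => ?_, ?_⟩
  · simpa [show e - (e - 1) = 1 by omega] using H.pow_dvd_of_mul_eq_zero h
  · rintro ⟨t, rfl⟩
    rw [← mul_assoc, ← pow_succ, H.pow_eq_zero_of_le (by omega), zero_mul]

theorem mk_pow_pred_mul_eq_zero_iff (H : IsChainGenerator γ e s) {r : R} :
    Ideal.Quotient.mk (Ideal.span {γ ^ s}) (γ ^ (s - 1) * r) = 0 ↔ residue R r = 0 := by
  have := H.lt
  have := H.pos
  rw [H.residue_eq_zero_iff, Ideal.Quotient.eq_zero_iff_mem, Ideal.mem_span_singleton]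
  refine ⟨fun h => ?_, ?_⟩
  · simpa [show s - (s - 1) = 1 by omega] using H.pow_dvd_of_pow_mul (by omega) h
  · rintro ⟨t, rfl⟩
    rw [← mul_assoc, ← pow_succ, show s - 1 + 1 = s by omega]
    exact dvd_mul_right _ _

/-- Each layer `γ ^ j R / γ ^ (j + 1) R` is a copy of the residue field, via multiplication by `γ ^
j`. -/
theorem card_quotient (H : IsChainGenerator γ e s) [Finite R] {j : ℕ} (hj : j ≤ e) :
    Nat.card (R ⧸ Ideal.span {γ ^ j}) = Nat.card (ResidueField R) ^ j := by
  induction j with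
  | zero =>
    have : Subsingleton (R ⧸ Ideal.span {γ ^ 0}) := by
      rw [pow_zero, Ideal.span_singleton_one]
      exact Ideal.Quotient.subsingleton_iff.2 rfl
    simp
  | succ j ih =>
    let I : Ideal R := Ideal.span {γ ^ (j + 1)}
    let J : Ideal R := Ideal.span {γ ^ j}
    have hIJ : I ≤ J := Ideal.span_singleton_le_span_singleton.2 (pow_dvd_pow γ j.le_succ)
    let g : (R ⧸ I) →+* (R ⧸ J) := Ideal.Quotient.factor hIJ
    have hg : Function.Surjective g := Ideal.Quotient.factor_surjective hIJ
    let f : R →+ (R ⧸ I) := (Ideal.Quotient.mk I : R →+ (R ⧸ I)).comp (AddMonoidHom.mulLeft (γ ^ j))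
    have hfr : f.range = g.toAddMonoidHom.ker := by
      ext x
      obtain ⟨x, rfl⟩ := Ideal.Quotient.mk_surjective x
      have : x ∈ J ↔ g (Ideal.Quotient.mk I x) = 0 := by
        rw [Ideal.Quotient.factor_mk, Ideal.Quotient.eq_zero_iff_mem]
      change _ ↔ g (Ideal.Quotient.mk I x) = 0
      rw [← this, Ideal.mem_span_singleton]
      constructor
      · rintro ⟨y, hy⟩
        have : γ ^ (j + 1) ∣ γ ^ j * y - x := by
          rw [← Ideal.mem_span_singleton]
          exact Ideal.Quotient.eq.1 hy
        have h2 : γ ^ j ∣ γ ^ j * y - x := (pow_dvd_pow γ j.le_succ).trans this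
        exact (dvd_sub_right (dvd_mul_right _ _)).1 h2
      · rintro ⟨y, rfl⟩
        exact ⟨y, rfl⟩
    have hfk : f.ker = (maximalIdeal R).toAddSubgroup := by
      ext x
      change Ideal.Quotient.mk I (γ ^ j * x) = 0 ↔ x ∈ maximalIdeal R
      rw [Ideal.Quotient.eq_zero_iff_mem, Ideal.mem_span_singleton, H.maximalIdeal_eq,
        Ideal.mem_span_singleton]
      refine ⟨fun h => ?_, fun h => by rw [pow_succ]; exact mul_dvd_mul_left _ h⟩
      simpa using H.pow_dvd_of_pow_mul hj h
    have h1 : Nat.card f.range = Nat.card (ResidueField R) := by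
      rw [← Nat.card_congr (QuotientAddGroup.quotientKerEquivRange f).toEquiv, hfk]
      rfl
    rw [AddSubgroup.card_eq_card_quotient_mul_card_addSubgroup g.toAddMonoidHom.ker, ← hfr, h1, hfr,
      Nat.card_congr (QuotientAddGroup.quotientKerEquivOfSurjective g.toAddMonoidHom hg).toEquiv,
      ih (by omega), pow_succ]

theorem card_eq (H : IsChainGenerator γ e s) [Finite R] :
    Nat.card R = Nat.card (ResidueField R) ^ e := by
  rw [← H.card_quotient le_rfl, H.pow_eq_zero, Ideal.span_singleton_zero]
  exact Nat.card_congr (RingEquiv.quotientBot R).symm.toEquiv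

end IsChainGenerator

end ChainRing

/-! ### The mixed space: socle, `γ ^ s`-torsion and reduction of the form -/

section MixedSpace

open IsLocalRing Submodule

/-- Every family in `B` has `|ker f| ^ k` lifts, and `|A| = |B| * |ker f|`. This counts the lifts of
orthonormal families. -/
theorem Nat.card_comp_mul {A B : Type*} [AddGroup A] [AddGroup B] [Finite A] (f : A →+ B)
    (hf : Function.Surjective f) {k : ℕ} (P : (Fin k → B) → Prop) :
    Nat.card {u : Fin k → A // P (f ∘ u)} * Nat.card B ^ k =
      Nat.card {x : Fin k → B // P x} * Nat.card A ^ k := by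
  have : Finite B := Finite.of_surjective f hf
  have := Fintype.ofFinite {x : Fin k → B // P x}
  have e : {u : Fin k → A // P (f ∘ u)} ≃
      Σ x : {x : Fin k → B // P x}, {u : Fin k → A // ∀ i, u i ∈ f ⁻¹' {x.1 i}} :=
    { toFun := fun u => ⟨⟨f ∘ u.1, u.2⟩, u.1, fun i => rfl⟩
      invFun := fun p => ⟨p.2.1, by
        have : f ∘ p.2.1 = p.1.1 := funext p.2.2
        rw [this]; exact p.1.2⟩
      left_inv := fun u => rfl
      right_inv := fun p => Sigma.subtype_ext (Subtype.ext (funext p.2.2)) rfl }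
  have h1 : Nat.card A = Nat.card B * Nat.card f.ker := by
    rw [AddSubgroup.card_eq_card_quotient_mul_card_addSubgroup f.ker,
      Nat.card_congr (QuotientAddGroup.quotientKerEquivOfSurjective f hf).toEquiv]
  have h2 (x : {x : Fin k → B // P x}) :
      Nat.card {u : Fin k → A // ∀ i, u i ∈ f ⁻¹' {x.1 i}} = Nat.card f.ker ^ k := by
    rw [Nat.card_congr Equiv.subtypePiEquivPi, Nat.card_pi, Finset.prod_congr rfl fun i _ =>
      Nat.card_congr (AddMonoidHom.fiberEquivKerOfSurjective hf (x.1 i))]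
    simp
  rw [Nat.card_congr e, Nat.card_sigma, Finset.sum_congr rfl fun x _ => h2 x, h1]
  simp only [Finset.sum_const, Finset.card_univ, smul_eq_mul, Nat.card_eq_fintype_card]
  ring

variable {R : Type*} [CommRing R] {γ : R} {e s a b : ℕ}

/-- The canonical surjection from `R ^ (a + b)` onto the mixed space. -/
def mixedMk (γ : R) (s : ℕ) {a b : ℕ} : ((Fin a → R) × (Fin b → R)) →ₗ[R] MixedSpace R γ s a b where
  toFun p := (p.1, fun j => Ideal.Quotient.mk _ (p.2 j))
  map_add' _ _ := rfl
  map_smul' _ _ := rfl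

theorem mixedMk_surjective (m : MixedSpace R γ s a b) : ∃ c d, m = mixedMk γ s (c, d) := by
  refine ⟨m.1, fun j => Quotient.out (m.2 j), Prod.ext rfl (funext fun j => ?_)⟩
  exact (Ideal.Quotient.mk_out _).symm

variable [IsLocalRing R]

/-- The reduction of the first block modulo the maximal ideal. -/
noncomputable def redFst (γ : R) (s a b : ℕ) :
    MixedSpace R γ s a b →ₛₗ[residue R] (Fin a → ResidueField R) where
  toFun m i := residue R (m.1 i)
  map_add' _ _ := by ext; simp
  map_smul' _ _ := by ext; simp

theorem redFst_mk (c : Fin a → R) (d : Fin b → R) :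
    redFst γ s a b (mixedMk γ s (c, d)) = residue R ∘ c := rfl

namespace IsChainGenerator

/-- The reduction map `R / γ ^ s R → R / γ R`. -/
noncomputable def redCheck (H : IsChainGenerator γ e s) : RCheck R γ s →+* ResidueField R :=
  Ideal.Quotient.lift _ (residue R) fun r hr => by
    rw [H.residue_eq_zero_iff]
    exact (dvd_pow_self γ H.pos.ne').trans (Ideal.mem_span_singleton.1 hr)

theorem redCheck_mk (H : IsChainGenerator γ e s) (r : R) :
    H.redCheck (Ideal.Quotient.mk _ r) = residue R r := rfl

/-- The reduction of the second block modulo the maximal ideal. -/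
noncomputable def redSnd (H : IsChainGenerator γ e s) (a b : ℕ) :
    MixedSpace R γ s a b →ₛₗ[residue R] (Fin b → ResidueField R) where
  toFun m j := H.redCheck (m.2 j)
  map_add' _ _ := by ext; simp
  map_smul' r m := by
    ext j
    obtain ⟨x, hx⟩ := Ideal.Quotient.mk_surjective (m.2 j)
    simp only [Prod.smul_snd, Pi.smul_apply, ← hx, smul_eq_mul]
    rw [← H.redCheck_mk r, ← map_mul]
    rfl

theorem redSnd_mk (H : IsChainGenerator γ e s) (c : Fin a → R) (d : Fin b → R) :
    H.redSnd a b (mixedMk γ s (c, d)) = residue R ∘ d := rfl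

/-- The general element of the socle. -/
def soc (γ : R) (e s : ℕ) (c : Fin a → R) (d : Fin b → R) : MixedSpace R γ s a b :=
  mixedMk γ s (γ ^ (e - 1) • c, γ ^ (s - 1) • d)

/-- The map `soc` as a linear map. -/
def socHom (γ : R) (e s a b : ℕ) : ((Fin a → R) × (Fin b → R)) →ₗ[R] MixedSpace R γ s a b :=
  (mixedMk γ s).comp ((γ ^ (e - 1) • LinearMap.id).prodMap (γ ^ (s - 1) • LinearMap.id))

omit [IsLocalRing R] in
theorem soc_eq_socHom (c : Fin a → R) (d : Fin b → R) :
    soc γ e s c d = socHom γ e s a b (c, d) := rfl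

theorem soc_eq_zero_iff (H : IsChainGenerator γ e s) {c : Fin a → R} {d : Fin b → R} :
    soc γ e s c d = 0 ↔ residue R ∘ c = 0 ∧ residue R ∘ d = 0 := by
  simp only [soc, Prod.ext_iff, funext_iff]
  refine and_congr (forall_congr' fun i => ?_) (forall_congr' fun i => ?_)
  · exact H.pow_pred_mul_eq_zero_iff
  · exact H.mk_pow_pred_mul_eq_zero_iff

theorem eq_soc_of_smul_eq_zero (H : IsChainGenerator γ e s) {m : MixedSpace R γ s a b}
    (h : γ • m = 0) : ∃ c d, m = soc γ e s c d := by
  have := H.lt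
  obtain ⟨c, d, rfl⟩ := mixedMk_surjective m
  rw [← map_smul] at h
  have h1 (i) : ∃ t, c i = γ ^ (e - 1) * t :=
    H.pow_dvd_of_mul_eq_zero (i := 1) (by rw [pow_one]; exact congrFun (congrArg Prod.fst h) i)
  have h2 (j) : ∃ t, d j = γ ^ (s - 1) * t := by
    have h3 : Ideal.Quotient.mk (Ideal.span {γ ^ s}) (γ * d j) = 0 :=
      congrFun (congrArg Prod.snd h) j
    rw [Ideal.Quotient.eq_zero_iff_mem, Ideal.mem_span_singleton] at h3
    exact H.pow_dvd_of_pow_mul (i := 1) (by omega) (by rwa [pow_one])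
  choose c' hc' using h1
  choose d' hd' using h2
  exact ⟨c', d', by rw [soc]; congr 1; exact Prod.ext (funext hc') (funext hd')⟩

omit [IsLocalRing R] in
theorem pow_smul_mk {i : ℕ} (hi : s ≤ i) (c : Fin a → R)
    (d : Fin b → R) : γ ^ i • mixedMk γ s (c, d) = mixedMk γ s (γ ^ i • c, 0) := by
  refine Prod.ext rfl (funext fun j => ?_)
  change Ideal.Quotient.mk _ (γ ^ i * d j) = Ideal.Quotient.mk _ 0
  rw [map_zero, Ideal.Quotient.eq_zero_iff_mem, Ideal.mem_span_singleton]
  exact (pow_dvd_pow γ hi).mul_right _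

/-- The last nonzero multiple of `x` by a power of `γ`; this is what reduces injectivity and LCD to
the socle. -/
theorem exists_pow_smul_ne_zero (H : IsChainGenerator γ e s) {M : Type*} [AddCommGroup M]
    [Module R M] {x : M} (hx : x ≠ 0) : ∃ n, γ ^ n • x ≠ 0 ∧ γ • γ ^ n • x = 0 := by
  have hex : ∃ n, γ ^ n • x = 0 := ⟨e, by rw [H.pow_eq_zero, zero_smul]⟩
  classical
  obtain ⟨n, hn⟩ : ∃ n, Nat.find hex = n + 1 := by
    refine ⟨Nat.find hex - 1, ?_⟩
    have : Nat.find hex ≠ 0 := by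
      intro h0
      have h1 := Nat.find_spec hex
      rw [h0, pow_zero, one_smul] at h1
      exact hx h1
    omega
  refine ⟨n, Nat.find_min hex (by omega), ?_⟩
  rw [smul_smul, ← pow_succ', ← hn]
  exact Nat.find_spec hex

theorem pow_pred_smul_mk (H : IsChainGenerator γ e s) (c : Fin a → R) (d : Fin b → R) :
    γ ^ (e - 1) • mixedMk γ s (c, d) = soc γ e s c 0 := by
  have := H.lt
  rw [pow_smul_mk (by omega), soc, smul_zero]

/-- The submodule of elements killed by `γ ^ s`. -/
abbrev tors (R : Type*) [CommRing R] (γ : R) (s a b : ℕ) : Submodule R (MixedSpace R γ s a b) :=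
  torsionBy R (MixedSpace R γ s a b) (γ ^ s)

theorem mem_tors_iff (H : IsChainGenerator γ e s) {m : MixedSpace R γ s a b} :
    m ∈ tors R γ s a b ↔ ∃ c d, m = mixedMk γ s (γ ^ (e - s) • c, d) := by
  have hlt := H.lt
  rw [mem_torsionBy_iff]
  constructor
  · intro h
    obtain ⟨c, d, rfl⟩ := mixedMk_surjective m
    rw [pow_smul_mk le_rfl] at h
    have h1 (i) : ∃ t, c i = γ ^ (e - s) * t :=
      H.pow_dvd_of_mul_eq_zero (congrFun (congrArg Prod.fst h) i)
    choose c' hc' using h1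
    exact ⟨c', d, by congr 2; exact funext hc'⟩
  · rintro ⟨c, d, rfl⟩
    rw [pow_smul_mk le_rfl, smul_smul, ← pow_add, show s + (e - s) = e by omega, H.pow_eq_zero,
      zero_smul]
    exact map_zero (mixedMk γ s)

theorem redFst_eq_zero_of_mem_tors (H : IsChainGenerator γ e s) {m : MixedSpace R γ s a b}
    (h : m ∈ tors R γ s a b) : redFst γ s a b m = 0 := by
  have hlt := H.lt
  obtain ⟨c, d, rfl⟩ := H.mem_tors_iff.1 h
  rw [redFst_mk]
  ext i
  change residue R (γ ^ (e - s) * c i) = 0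
  rw [H.residue_eq_zero_iff]
  exact (dvd_pow_self γ (by omega)).mul_right _

theorem pow_smul_of_mem_tors (H : IsChainGenerator γ e s) (c : Fin a → R) (d : Fin b → R) :
    γ ^ (s - 1) • mixedMk γ s (γ ^ (e - s) • c, d) = soc γ e s c d := by
  have := H.lt
  have := H.pos
  rw [← map_smul, Prod.smul_mk, smul_smul, ← pow_add, soc]
  congr 4
  omega

/-! ### Cardinalities -/

section Finite

variable [Finite R]

theorem card_mixedSpace (H : IsChainGenerator γ e s) (a b : ℕ) :
    Nat.card (MixedSpace R γ s a b) = Nat.card (ResidueField R) ^ (e * a + s * b) := by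
  rw [Nat.card_prod, Nat.card_fun, Nat.card_fun, H.card_quotient H.lt.le, H.card_eq, Nat.card_fin,
    Nat.card_fin, ← pow_mul, ← pow_mul, pow_add]

theorem card_tors (H : IsChainGenerator γ e s) (a b : ℕ) :
    Nat.card (tors R γ s a b) = Nat.card (ResidueField R) ^ (s * a + s * b) := by
  have hlt := H.lt
  have hd (r r' : R) : Ideal.Quotient.mk (Ideal.span {γ ^ s}) r = Ideal.Quotient.mk _ r' ↔
      γ ^ (e - s) * r = γ ^ (e - s) * r' := by
    rw [Ideal.Quotient.eq, Ideal.mem_span_singleton, ← sub_eq_zero (a := γ ^ (e - s) * r), ← mul_sub]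
    constructor
    · rintro ⟨t, ht⟩
      rw [ht, ← mul_assoc, ← pow_add, H.pow_eq_zero_of_le (by omega), zero_mul]
    · intro h
      simpa [show e - (e - s) = s by omega] using H.pow_dvd_of_mul_eq_zero h
  -- Multiplication by `γ ^ (e - s)` identifies `R / γ ^ s R` with the annihilator of `γ ^ s` in
  -- `R`.
  let f : (Fin a → RCheck R γ s) × (Fin b → RCheck R γ s) → tors R γ s a b := fun p =>
    ⟨(fun i => γ ^ (e - s) * Quotient.out (p.1 i), p.2), H.mem_tors_iff.2
      ⟨fun i => Quotient.out (p.1 i), fun i => Quotient.out (p.2 i),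
        Prod.ext rfl (funext fun j => (Ideal.Quotient.mk_out _).symm)⟩⟩
  have hf : Function.Bijective f := by
    constructor
    · rintro ⟨x, y⟩ ⟨x', y'⟩ h
      have h1 := congrArg (fun m => m.1.2) h
      have h2 := congrArg (fun m => m.1.1) h
      refine Prod.ext (funext fun i => ?_) h1
      have h3 := (hd _ _).2 (congrFun h2 i)
      exact (Ideal.Quotient.mk_out _).symm.trans (h3.trans (Ideal.Quotient.mk_out _))
    · rintro ⟨m, hm⟩
      obtain ⟨c, d, rfl⟩ := H.mem_tors_iff.1 hm
      refine ⟨(fun i => Ideal.Quotient.mk _ (c i), fun j => Ideal.Quotient.mk _ (d j)), ?_⟩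
      refine Subtype.ext (Prod.ext (funext fun i => ?_) rfl)
      exact (hd _ _).1 (Ideal.Quotient.mk_out _)
  rw [← Nat.card_congr (Equiv.ofBijective f hf), Nat.card_prod, Nat.card_fun, Nat.card_fun,
    H.card_quotient H.lt.le, Nat.card_fin, Nat.card_fin, ← pow_mul, ← pow_mul, pow_add]

end Finite

/-! ### The form and the LCD condition -/

variable {τ : R ≃+* R} {φ : ResidueField R →+* ResidueField R}

theorem mixedForm_mk (H : IsChainGenerator γ e s) (τ : R ≃+* R) (c c' : Fin a → R)
    (d d' : Fin b → R) :
    mixedForm τ γ e s (mixedMk γ s (c, d)) (mixedMk γ s (c', d')) =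
      ∑ i, c i * τ (c' i) + γ ^ (e - s) * ∑ j, d j * τ (d' j) :=
  mixedForm_eq_of_mk τ γ e s H.maximalIdeal_eq H.pow_eq_zero H.lt.le _ _ d d'
    (fun _ => rfl) (fun _ => rfl)

theorem mixedForm_smul_left (H : IsChainGenerator γ e s) (τ : R ≃+* R) (r : R)
    (m m' : MixedSpace R γ s a b) :
    mixedForm τ γ e s (r • m) m' = r * mixedForm τ γ e s m m' := by
  obtain ⟨c, d, rfl⟩ := mixedMk_surjective m
  obtain ⟨c', d', rfl⟩ := mixedMk_surjective m'
  rw [← map_smul, Prod.smul_mk, H.mixedForm_mk, H.mixedForm_mk, mul_add, mul_left_comm,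
    Finset.mul_sum, Finset.mul_sum (a := r)]
  simp [mul_assoc, mul_left_comm r, Finset.mul_sum]

theorem mixedForm_soc_eq_zero_iff (H : IsChainGenerator γ e s)
    (hτ : ∀ x, residue R (τ x) = φ (residue R x)) (c : Fin a → R) (d : Fin b → R)
    (m : MixedSpace R γ s a b) :
    mixedForm τ γ e s (soc γ e s c d) m = 0 ↔
      herm φ (residue R ∘ c) (redFst γ s a b m) + herm φ (residue R ∘ d) (H.redSnd a b m) = 0 := by
  have := H.lt
  have := H.pos
  obtain ⟨c', d', rfl⟩ := mixedMk_surjective m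
  rw [soc, H.mixedForm_mk, redFst_mk, H.redSnd_mk]
  have h1 : ∑ i, (γ ^ (e - 1) • c) i * τ (c' i) +
      γ ^ (e - s) * ∑ j, (γ ^ (s - 1) • d) j * τ (d' j) =
      γ ^ (e - 1) * (∑ i, c i * τ (c' i) + ∑ j, d j * τ (d' j)) := by
    simp only [Pi.smul_apply, smul_eq_mul, mul_assoc, ← Finset.mul_sum, mul_add]
    -- The weight `γ ^ (e - s)` brings the second block to the same level `γ ^ (e - 1)` as the
    -- first.
    rw [← mul_assoc (γ ^ (e - s)), ← pow_add, show e - s + (s - 1) = e - 1 by omega]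
  rw [h1, H.pow_pred_mul_eq_zero_iff]
  simp [herm, hτ]

/-- The LCD condition only has to be tested on the socle. -/
theorem lcd_iff (H : IsChainGenerator γ e s) (hτ : ∀ x, residue R (τ x) = φ (residue R x))
    (C : Submodule R (MixedSpace R γ s a b)) :
    (C : Set (MixedSpace R γ s a b)) ∩ {m | ∀ m' ∈ C, mixedForm τ γ e s m m' = 0} = {0} ↔
      ∀ c d, soc γ e s c d ∈ C → (∀ m ∈ C, herm φ (residue R ∘ c) (redFst γ s a b m) +
        herm φ (residue R ∘ d) (H.redSnd a b m) = 0) → residue R ∘ c = 0 ∧ residue R ∘ d = 0 := by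
  constructor
  · intro h c d hC horth
    rw [← H.soc_eq_zero_iff]
    refine h.subset ⟨hC, fun m hm => ?_⟩
    rw [H.mixedForm_soc_eq_zero_iff hτ]
    exact horth m hm
  · intro h
    refine Set.Subset.antisymm ?_ ?_
    · rintro x ⟨hx, horth⟩
      by_contra hx0
      obtain ⟨n, h1, h2⟩ := H.exists_pow_smul_ne_zero hx0
      obtain ⟨c, d, hcd⟩ := H.eq_soc_of_smul_eq_zero h2
      apply h1
      rw [hcd, H.soc_eq_zero_iff]
      refine h c d (hcd ▸ C.smul_mem _ hx) fun m hm => ?_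
      rw [← H.mixedForm_soc_eq_zero_iff hτ, ← hcd, H.mixedForm_smul_left, horth m hm, mul_zero]
    · rintro _ rfl
      refine ⟨C.zero_mem, fun m _ => ?_⟩
      rw [← zero_smul R (0 : MixedSpace R γ s a b), H.mixedForm_smul_left, zero_mul]

end IsChainGenerator

end MixedSpace

/-! ### Frames and the codes they generate -/

section Frames

open IsLocalRing Submodule

variable {R : Type*} [CommRing R] [IsLocalRing R] {γ : R} {e s a b k l : ℕ}

namespace IsChainGenerator

/-- A pair of families in the mixed space, orthonormal modulo the maximal ideal in the first and
second block respectively, the second one being killed by `γ ^ s`. -/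
structure IsFrame (H : IsChainGenerator γ e s) (φ : ResidueField R →+* ResidueField R)
    (t : (Fin k → MixedSpace R γ s a b) × (Fin l → MixedSpace R γ s a b)) : Prop where
  fst : HermOrthonormal φ fun i => redFst γ s a b (t.1 i)
  tors : ∀ j, t.2 j ∈ tors R γ s a b
  snd : HermOrthonormal φ fun j => H.redSnd a b (t.2 j)

/-- The linear map sending the standard generators of the mixed space of block-length `(k, l)` to
the given families. -/
def frameMap (t : (Fin k → MixedSpace R γ s a b) × (Fin l → MixedSpace R γ s a b))
    (ht : ∀ j, t.2 j ∈ IsChainGenerator.tors R γ s a b) :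
    MixedSpace R γ s k l →ₗ[R] MixedSpace R γ s a b :=
  (Fintype.linearCombination R t.1).coprod (LinearMap.lsum R (fun _ => RCheck R γ s) ℕ fun j =>
    Submodule.liftQ (Ideal.span {γ ^ s}) (LinearMap.toSpanSingleton R _ (t.2 j)) (by
      refine (Submodule.span_singleton_le_iff_mem _ _).2 ?_
      exact ht j))

variable {t : (Fin k → MixedSpace R γ s a b) × (Fin l → MixedSpace R γ s a b)}

omit [IsLocalRing R] in
theorem frameMap_mk (ht : ∀ j, t.2 j ∈ IsChainGenerator.tors R γ s a b) (r : Fin k → R)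
    (x : Fin l → R) :
    frameMap t ht (mixedMk γ s (r, x)) = ∑ i, r i • t.1 i + ∑ j, x j • t.2 j := by
  rw [frameMap, LinearMap.coprod_apply, LinearMap.lsum_apply, LinearMap.sum_apply]
  rfl

theorem redFst_frameMap (H : IsChainGenerator γ e s)
    (ht : ∀ j, t.2 j ∈ IsChainGenerator.tors R γ s a b)
    (z : MixedSpace R γ s k l) :
    redFst γ s a b (frameMap t ht z) = ∑ i, redFst γ s k l z i • redFst γ s a b (t.1 i) := by
  obtain ⟨r, x, rfl⟩ := mixedMk_surjective z
  rw [frameMap_mk, map_add, map_sum, map_sum]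
  simp only [LinearMap.map_smulₛₗ, H.redFst_eq_zero_of_mem_tors (ht _), smul_zero,
    Finset.sum_const_zero, add_zero]
  rfl

theorem redSnd_frameMap (H : IsChainGenerator γ e s)
    (ht : ∀ j, t.2 j ∈ IsChainGenerator.tors R γ s a b)
    {z : MixedSpace R γ s k l} (hz : z ∈ IsChainGenerator.tors R γ s k l) :
    H.redSnd a b (frameMap t ht z) = ∑ j, H.redSnd k l z j • H.redSnd a b (t.2 j) := by
  obtain ⟨r, x, rfl⟩ := mixedMk_surjective z
  have h1 (i) : residue R (r i) = 0 := congrFun (H.redFst_eq_zero_of_mem_tors hz) i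
  rw [frameMap_mk, map_add, map_sum, map_sum]
  simp only [LinearMap.map_smulₛₗ, h1, zero_smul, Finset.sum_const_zero, zero_add]
  rfl

/-- The value of `frameMap` on the socle. -/
theorem frameMap_soc (H : IsChainGenerator γ e s)
    (ht : ∀ j, t.2 j ∈ IsChainGenerator.tors R γ s a b) (r : Fin k → R) (x : Fin l → R) :
    ∃ (c : Fin a → R) (d : Fin b → R) (y : Fin l → Fin a → ResidueField R),
      frameMap t ht (soc γ e s r x) = soc γ e s c d ∧
      residue R ∘ c = ∑ i, residue R (r i) • redFst γ s a b (t.1 i) + ∑ j, residue R (x j) • y j ∧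
      residue R ∘ d = ∑ j, residue R (x j) • H.redSnd a b (t.2 j) := by
  choose cu du hu using fun i => mixedMk_surjective (t.1 i)
  choose cv dv hv using fun j => H.mem_tors_iff.1 (ht j)
  refine ⟨∑ i, r i • cu i + ∑ j, x j • cv j, ∑ j, x j • dv j, fun j => residue R ∘ cv j, ?_, ?_, ?_⟩
  · have h1 : frameMap t ht (soc γ e s r x) =
        ∑ i, r i • soc γ e s (cu i) 0 + ∑ j, x j • soc γ e s (cv j) (dv j) := by
      rw [soc, frameMap_mk]
      congr 1
      · refine Finset.sum_congr rfl fun i _ => ?_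
        rw [← H.pow_pred_smul_mk _ (du i), ← hu, smul_smul, mul_comm]
        rfl
      · refine Finset.sum_congr rfl fun j _ => ?_
        rw [← H.pow_smul_of_mem_tors, ← hv, smul_smul, mul_comm]
        rfl
    rw [h1]
    simp only [soc_eq_socHom, ← map_smul, ← map_sum, ← map_add]
    congr 1
    ext <;> simp [Prod.fst_sum, Prod.snd_sum]
  · ext n
    simp [hu, redFst_mk]
  · ext n
    simp [hv, redSnd_mk]

theorem soc_eq_soc_iff (H : IsChainGenerator γ e s) {c c' : Fin a → R} {d d' : Fin b → R} :
    soc γ e s c d = soc γ e s c' d' ↔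
      residue R ∘ c = residue R ∘ c' ∧ residue R ∘ d = residue R ∘ d' := by
  rw [soc_eq_socHom, soc_eq_socHom, ← sub_eq_zero, ← map_sub, Prod.mk_sub_mk, ← soc_eq_socHom,
    H.soc_eq_zero_iff, ← sub_eq_zero, ← sub_eq_zero (a := residue R ∘ d)]
  refine and_congr ?_ ?_ <;> · simp [funext_iff, sub_eq_zero]

namespace IsFrame

variable {H : IsChainGenerator γ e s} {φ : ResidueField R →+* ResidueField R}

/-- A socle element of the range of `frameMap` that is orthogonal to the frame vanishes. -/
theorem eq_zero_of_orthogonal (ht : H.IsFrame φ t) {r : Fin k → R} {x : Fin l → R}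
    {c : Fin a → R} {d : Fin b → R} (hcd : frameMap t ht.tors (soc γ e s r x) = soc γ e s c d)
    (hu : ∀ i, herm φ (residue R ∘ c) (redFst γ s a b (t.1 i)) +
      herm φ (residue R ∘ d) (H.redSnd a b (t.1 i)) = 0)
    (hv : ∀ j, herm φ (residue R ∘ c) (redFst γ s a b (t.2 j)) +
      herm φ (residue R ∘ d) (H.redSnd a b (t.2 j)) = 0) : soc γ e s r x = (0 : MixedSpace R γ s k l) := by
  obtain ⟨c', d', y, h1, h2, h3⟩ := H.frameMap_soc ht.tors r x
  rw [hcd, H.soc_eq_soc_iff] at h1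
  rw [h1.1, h1.2] at hu hv
  -- The system is triangular: the `v j` vanish in the first block modulo `γ`, so pairing with them
  -- isolates the `x j`; once these are `0`, pairing with the `u i` isolates the `r i`.
  have hx (j) : residue R (x j) = 0 := by
    have h4 := hv j
    rw [H.redFst_eq_zero_of_mem_tors (ht.tors j), herm_zero_right, zero_add, h3] at h4
    rw [← ht.snd.herm_sum_smul_left (fun j => residue R (x j)) j, h4]
  simp only [hx, zero_smul, Finset.sum_const_zero, add_zero] at h2 h3
  have hr (i) : residue R (r i) = 0 := by
    have h4 := hu i
    rw [h3, herm_zero_left, add_zero, h2] at h4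
    rw [← ht.fst.herm_sum_smul_left (fun i => residue R (r i)) i, h4]
  exact H.soc_eq_zero_iff.2 ⟨funext hr, funext hx⟩

theorem frameMap_injective (ht : H.IsFrame φ t) : Function.Injective (frameMap t ht.tors) := by
  rw [injective_iff_map_eq_zero]
  intro z hz
  by_contra hz0
  obtain ⟨n, h1, h2⟩ := H.exists_pow_smul_ne_zero hz0
  obtain ⟨r, x, hrx⟩ := H.eq_soc_of_smul_eq_zero h2
  refine h1 (hrx.trans (ht.eq_zero_of_orthogonal (c := 0) (d := 0) ?_ ?_ ?_))
  · rw [← hrx, map_smul, hz, smul_zero]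
    exact (map_zero (socHom γ e s a b)).symm
  · intro i
    have h3 (n : ℕ) : residue R ∘ (0 : Fin n → R) = 0 := by ext; simp
    rw [h3, h3, herm_zero_left, herm_zero_left, add_zero]
  · intro i
    have h3 (n : ℕ) : residue R ∘ (0 : Fin n → R) = 0 := by ext; simp
    rw [h3, h3, herm_zero_left, herm_zero_left, add_zero]

theorem fst_mem_range (ht : H.IsFrame φ t) (i : Fin k) :
    t.1 i ∈ LinearMap.range (frameMap t ht.tors) := by
  refine ⟨mixedMk γ s (Pi.single i 1, 0), ?_⟩
  rw [frameMap_mk]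
  simp [Pi.single_apply]

theorem snd_mem_range (ht : H.IsFrame φ t) (j : Fin l) :
    t.2 j ∈ LinearMap.range (frameMap t ht.tors) := by
  refine ⟨mixedMk γ s (0, Pi.single j 1), ?_⟩
  rw [frameMap_mk]
  simp [Pi.single_apply]

theorem mem_tors_iff (ht : H.IsFrame φ t) {z : MixedSpace R γ s k l} :
    frameMap t ht.tors z ∈ IsChainGenerator.tors R γ s a b ↔
      z ∈ IsChainGenerator.tors R γ s k l := by
  rw [mem_torsionBy_iff, mem_torsionBy_iff, ← map_smul, map_eq_zero_iff _ ht.frameMap_injective]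

end IsFrame

/-- The LCD condition on a code, tested on its socle. -/
def SocleLCD (H : IsChainGenerator γ e s) (φ : ResidueField R →+* ResidueField R)
    (C : Submodule R (MixedSpace R γ s a b)) : Prop :=
  ∀ c d, soc γ e s c d ∈ C → (∀ m ∈ C, herm φ (residue R ∘ c) (redFst γ s a b m) +
    herm φ (residue R ∘ d) (H.redSnd a b m) = 0) → residue R ∘ c = 0 ∧ residue R ∘ d = 0

/-- The reduction of the first block of a code. -/
noncomputable def codeFst (C : Submodule R (MixedSpace R γ s a b)) :
    Submodule (ResidueField R) (Fin a → ResidueField R) :=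
  have : RingHomSurjective (residue R) := ⟨residue_surjective⟩
  C.map (redFst γ s a b)

/-- The reduction of the second block of the part of a code that is killed by `γ ^ s`. -/
noncomputable def codeSnd (H : IsChainGenerator γ e s) (C : Submodule R (MixedSpace R γ s a b)) :
    Submodule (ResidueField R) (Fin b → ResidueField R) :=
  have : RingHomSurjective (residue R) := ⟨residue_surjective⟩
  (C ⊓ tors R γ s a b).map (H.redSnd a b)

namespace IsFrame

variable {H : IsChainGenerator γ e s} {φ : ResidueField R →+* ResidueField R}

theorem socleLCD (ht : H.IsFrame φ t) : H.SocleLCD φ (LinearMap.range (frameMap t ht.tors)) := by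
  rintro c d ⟨z, hz⟩ horth
  have hγz : γ • z = 0 := by
    apply ht.frameMap_injective
    have h0 := H.lt
    have h1 := H.pos
    rw [map_smul, hz, map_zero, soc, ← map_smul, Prod.smul_mk, smul_smul, smul_smul, ← pow_succ',
      ← pow_succ', Nat.sub_add_cancel (by omega), Nat.sub_add_cancel h1, H.pow_eq_zero, zero_smul]
    refine Prod.ext rfl (funext fun j => ?_)
    change Ideal.Quotient.mk _ (γ ^ s * d j) = 0
    rw [Ideal.Quotient.eq_zero_iff_mem, Ideal.mem_span_singleton]
    exact dvd_mul_right _ _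
  obtain ⟨r, x, rfl⟩ := H.eq_soc_of_smul_eq_zero hγz
  have h1 := ht.eq_zero_of_orthogonal hz (fun i => horth _ (ht.fst_mem_range i))
    (fun j => horth _ (ht.snd_mem_range j))
  rw [← H.soc_eq_zero_iff, ← hz, h1, map_zero]

theorem codeFst_range (ht : H.IsFrame φ t) : codeFst (LinearMap.range (frameMap t ht.tors)) =
    span (ResidueField R) (Set.range fun i => redFst γ s a b (t.1 i)) := by
  apply le_antisymm
  · rintro _ ⟨_, ⟨z, rfl⟩, rfl⟩
    rw [H.redFst_frameMap]
    exact sum_mem fun i _ => smul_mem _ _ (subset_span ⟨i, rfl⟩)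
  · rw [span_le]
    rintro _ ⟨i, rfl⟩
    exact ⟨_, ht.fst_mem_range i, rfl⟩

theorem codeSnd_range (ht : H.IsFrame φ t) : H.codeSnd (LinearMap.range (frameMap t ht.tors)) =
    span (ResidueField R) (Set.range fun j => H.redSnd a b (t.2 j)) := by
  apply le_antisymm
  · rintro _ ⟨_, ⟨⟨z, rfl⟩, hz⟩, rfl⟩
    rw [H.redSnd_frameMap ht.tors (ht.mem_tors_iff.1 hz)]
    exact sum_mem fun i _ => smul_mem _ _ (subset_span ⟨i, rfl⟩)
  · rw [span_le]
    rintro _ ⟨j, rfl⟩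
    exact ⟨_, ⟨ht.snd_mem_range j, ht.tors j⟩, rfl⟩

theorem finrank_codeFst (ht : H.IsFrame φ t) :
    Module.finrank (ResidueField R) (codeFst (LinearMap.range (frameMap t ht.tors))) = k := by
  rw [ht.codeFst_range]
  exact ht.fst.finrank_span

theorem finrank_codeSnd (ht : H.IsFrame φ t) :
    Module.finrank (ResidueField R) (H.codeSnd (LinearMap.range (frameMap t ht.tors))) = l := by
  rw [ht.codeSnd_range]
  exact ht.snd.finrank_span

/-- On reductions `frameMap` is an isometry, orthonormal families preserving coordinates, and by
injectivity it detects torsion. So frames inside a code correspond to frames of the model space. -/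
theorem comp_iff (ht : H.IsFrame φ t) {k' l' : ℕ}
    {t' : (Fin k' → MixedSpace R γ s k l) × (Fin l' → MixedSpace R γ s k l)} :
    H.IsFrame φ (k := k') (l := l')
      (fun i => frameMap t ht.tors (t'.1 i), fun j => frameMap t ht.tors (t'.2 j)) ↔
      H.IsFrame φ t' := by
  have h1 : (HermOrthonormal φ fun i => redFst γ s a b (frameMap t ht.tors (t'.1 i))) ↔
      HermOrthonormal φ fun i => redFst γ s k l (t'.1 i) := by
    simp only [HermOrthonormal, H.redFst_frameMap]
    exact forall_congr' fun i => forall_congr' fun j => by rw [← ht.fst.herm_sum_sum]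
  have h2 (h : ∀ j, t'.2 j ∈ IsChainGenerator.tors R γ s k l) :
      (HermOrthonormal φ fun j => H.redSnd a b (frameMap t ht.tors (t'.2 j))) ↔
      HermOrthonormal φ fun j => H.redSnd k l (t'.2 j) := by
    simp only [HermOrthonormal, H.redSnd_frameMap ht.tors (h _)]
    exact forall_congr' fun i => forall_congr' fun j => by rw [← ht.snd.herm_sum_sum]
  constructor
  · rintro ⟨h3, h4, h5⟩
    have h6 := fun j => ht.mem_tors_iff.1 (h4 j)
    exact ⟨h1.1 h3, h6, (h2 h6).1 h5⟩
  · rintro ⟨h3, h4, h5⟩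
    exact ⟨h1.2 h3, fun j => ht.mem_tors_iff.2 (h4 j), (h2 h4).2 h5⟩

end IsFrame

end IsChainGenerator

end Frames

/-! ### Every LCD code is generated by a frame -/

section FrameOfLCD

open IsLocalRing Submodule

variable {R : Type*} [CommRing R] [IsLocalRing R] {γ : R} {e s a b k l : ℕ}

namespace IsChainGenerator

variable {H : IsChainGenerator γ e s} {φ : ResidueField R →+* ResidueField R}
  {C : Submodule R (MixedSpace R γ s a b)}

theorem exists_residue_comp_eq {n : ℕ} (x : Fin n → ResidueField R) :
    ∃ c : Fin n → R, x = residue R ∘ c := by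
  choose c hc using fun i => residue_surjective (x i)
  exact ⟨c, (funext hc).symm⟩

theorem residue_comp_sub {n : ℕ} (c d : Fin n → R) :
    residue R ∘ (c - d) = residue R ∘ c - residue R ∘ d := by
  ext; simp

theorem residue_comp_zero (n : ℕ) : residue R ∘ (0 : Fin n → R) = 0 := by
  ext; simp

theorem residue_comp_sum_smul {n k : ℕ} (r : Fin k → R) (c : Fin k → Fin n → R) :
    residue R ∘ (∑ i, r i • c i) = ∑ i, residue R (r i) • (residue R ∘ c i) := by
  ext; simp

theorem exists_eq_smul (H : IsChainGenerator γ e s) {n : ℕ} {c : Fin n → R}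
    (hc : residue R ∘ c = 0) : ∃ c', c = γ • c' := by
  choose c' hc' using fun i => H.residue_eq_zero_iff.1 (congrFun hc i)
  exact ⟨c', funext hc'⟩

theorem soc_zero_mem (H : IsChainGenerator γ e s) {c : Fin a → R} {d : Fin b → R}
    (h : mixedMk γ s (c, d) ∈ C) : soc γ e s c 0 ∈ C := by
  rw [← H.pow_pred_smul_mk c d]
  exact C.smul_mem _ h

omit [IsLocalRing R] in
theorem soc_sub (c c' : Fin a → R) (d d' : Fin b → R) :
    soc γ e s (c - c') (d - d') = soc γ e s c d - soc γ e s c' d' := by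
  simp only [soc_eq_socHom, ← map_sub, Prod.mk_sub_mk]

omit [IsLocalRing R] in
theorem soc_sum_smul {n : ℕ} (r : Fin n → R) (c : Fin n → Fin a → R) (d : Fin n → Fin b → R) :
    soc γ e s (∑ i, r i • c i) (∑ i, r i • d i) = ∑ i, r i • soc γ e s (c i) (d i) := by
  simp only [soc_eq_socHom, ← map_smul, ← map_sum]
  congr 1
  ext <;> simp [Prod.fst_sum, Prod.snd_sum]

omit [IsLocalRing R] in
theorem soc_sum_smul_zero_mem {n : ℕ} {c : Fin n → Fin a → R}
    (h : ∀ i, soc γ e s (c i) (0 : Fin b → R) ∈ C) (r : Fin n → R) :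
    soc γ e s (∑ i, r i • c i) 0 ∈ C := by
  have h1 := soc_sum_smul (γ := γ) (e := e) (s := s) r c fun _ => (0 : Fin b → R)
  simp only [smul_zero, Finset.sum_const_zero] at h1
  rw [h1]
  exact sum_mem fun i _ => C.smul_mem _ (h i)

namespace SocleLCD

theorem nondegenerate_codeFst (hC : H.SocleLCD φ C) : HermNondegenerate φ (codeFst C) := by
  rintro _ ⟨m, hm, rfl⟩ horth
  obtain ⟨c, d, rfl⟩ := mixedMk_surjective m
  refine (hC c 0 (H.soc_zero_mem hm) fun m' hm' => ?_).1
  rw [residue_comp_zero, herm_zero_left, add_zero]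
  exact horth _ ⟨m', hm', rfl⟩

variable {u : Fin k → MixedSpace R γ s a b}

/-- Subtracting the orthogonal projection onto `codeFst C` leaves a socle element of `C` orthogonal
to `C`, which the LCD condition kills. -/
theorem residue_mem_codeFst (hC : H.SocleLCD φ C) (hu : ∀ i, u i ∈ C)
    (hf : HermOrthonormal φ fun i => redFst γ s a b (u i))
    (hspan : span (ResidueField R) (Set.range fun i => redFst γ s a b (u i)) = codeFst C)
    {c : Fin a → R} (hc : soc γ e s c (0 : Fin b → R) ∈ C) : residue R ∘ c ∈ codeFst C := by
  choose cu du hcu using fun i => mixedMk_surjective (u i)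
  obtain ⟨r, hr⟩ := exists_residue_comp_eq fun i => herm φ (residue R ∘ c) (redFst γ s a b (u i))
  have hmem : soc γ e s (c - ∑ i, r i • cu i) (0 : Fin b → R) ∈ C := by
    rw [← sub_zero (0 : Fin b → R), soc_sub]
    refine C.sub_mem hc (soc_sum_smul_zero_mem (fun i => H.soc_zero_mem (d := du i) ?_) r)
    rw [← hcu]
    exact hu i
  have hsum : residue R ∘ (∑ i, r i • cu i) =
      ∑ i, residue R (r i) • redFst γ s a b (u i) := by
    simp only [residue_comp_sum_smul, hcu, redFst_mk]
  have h0 := (hC _ _ hmem fun m hm => ?_).1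
  · rw [residue_comp_sub, sub_eq_zero, hsum] at h0
    rw [h0, ← hspan]
    exact sum_mem fun i _ => smul_mem _ _ (subset_span ⟨i, rfl⟩)
  · rw [residue_comp_zero, herm_zero_left, add_zero]
    have hm' : redFst γ s a b m ∈ codeFst C := ⟨m, hm, rfl⟩
    rw [← hspan, mem_span_range_iff_exists_fun] at hm'
    obtain ⟨x, hx⟩ := hm'
    rw [← hx, herm_sum_right]
    refine Finset.sum_eq_zero fun i _ => ?_
    rw [herm_smul_right, residue_comp_sub, herm_sub_left, hsum,
      hf.herm_sum_smul_left (fun i => residue R (r i)) i]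
    have := congrFun hr i
    simp only [Function.comp_apply] at this
    rw [this, sub_self, mul_zero]

/-- Successive approximation: multiples of the `u i` raise the power of `γ` dividing the first
block, one step at a time, up to `γ ^ (e - s)`. -/
theorem exists_sub_mem_tors (hC : H.SocleLCD φ C) (hu : ∀ i, u i ∈ C)
    (hf : HermOrthonormal φ fun i => redFst γ s a b (u i))
    (hspan : span (ResidueField R) (Set.range fun i => redFst γ s a b (u i)) = codeFst C)
    {m : MixedSpace R γ s a b} (hm : m ∈ C) :
    ∃ r : Fin k → R, m - ∑ i, r i • u i ∈ tors R γ s a b := by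
  choose cu du hcu using fun i => mixedMk_surjective (u i)
  suffices ∀ n ≤ e - s, ∃ (r : Fin k → R) (c : Fin a → R) (d : Fin b → R),
      m - ∑ i, r i • u i = mixedMk γ s (γ ^ n • c, d) by
    obtain ⟨r, c, d, h⟩ := this _ le_rfl
    exact ⟨r, H.mem_tors_iff.2 ⟨c, d, h⟩⟩
  intro n
  induction n with
  | zero =>
    intro _
    obtain ⟨c, d, h⟩ := mixedMk_surjective m
    exact ⟨0, c, d, by simp [h]⟩
  | succ n ih =>
    intro hn
    have hlt := H.lt
    obtain ⟨r, c, d, h⟩ := ih (by omega)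
    have h1 : soc γ e s c (0 : Fin b → R) ∈ C := by
      -- Since `n < e - s`, the multiplier is at least `γ ^ s` and removes the second block.
      have h2 : γ ^ (e - 1 - n) • mixedMk γ s (γ ^ n • c, d) ∈ C := by
        rw [← h]
        exact C.smul_mem _ (C.sub_mem hm (sum_mem fun i _ => C.smul_mem _ (hu i)))
      rw [pow_smul_mk (by omega), smul_smul, ← pow_add, show e - 1 - n + n = e - 1 by omega] at h2
      rwa [soc, smul_zero]
    have h3 := hC.residue_mem_codeFst hu hf hspan h1
    rw [← hspan, mem_span_range_iff_exists_fun] at h3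
    obtain ⟨x, hx⟩ := h3
    obtain ⟨ρ, rfl⟩ := exists_residue_comp_eq x
    obtain ⟨c', hc'⟩ := H.exists_eq_smul (c := c - ∑ i, ρ i • cu i) (by
      rw [residue_comp_sub, residue_comp_sum_smul, ← hx, sub_eq_zero]
      simp only [hcu, redFst_mk]
      rfl)
    refine ⟨fun i => r i + γ ^ n * ρ i, c', d - ∑ i, (γ ^ n * ρ i) • du i, ?_⟩
    have h4 : m - ∑ i, (r i + γ ^ n * ρ i) • u i =
        mixedMk γ s (γ ^ n • c, d) - ∑ i, (γ ^ n * ρ i) • u i := by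
      rw [← h]
      simp only [add_smul, Finset.sum_add_distrib, sub_add_eq_sub_sub]
    rw [h4]
    simp only [hcu, ← map_smul, ← map_sum, ← map_sub]
    congr 1
    refine Prod.ext ?_ ?_
    · rw [pow_succ, mul_smul, ← hc', smul_sub, Finset.smul_sum]
      simp [Prod.fst_sum, mul_smul]
    · simp [Prod.snd_sum]

/-- Correct `c` by the `u i` until the total product with every `u i` vanishes. The rest of `C` is
torsion, where only `d` contributes, and that contribution is zero by `horth`; LCD then applies. -/
theorem residue_eq_zero (hC : H.SocleLCD φ C) (hu : ∀ i, u i ∈ C)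
    (hf : HermOrthonormal φ fun i => redFst γ s a b (u i))
    (hspan : span (ResidueField R) (Set.range fun i => redFst γ s a b (u i)) = codeFst C)
    {c : Fin a → R} {d : Fin b → R} (hcd : soc γ e s c d ∈ C)
    (horth : ∀ y ∈ H.codeSnd C, herm φ (residue R ∘ d) y = 0) :
    residue R ∘ d = 0 ∧ residue R ∘ c ∈ codeFst C := by
  choose cu du hcu using fun i => mixedMk_surjective (u i)
  obtain ⟨r, hr⟩ := exists_residue_comp_eq fun i =>
    herm φ (residue R ∘ c) (redFst γ s a b (u i)) + herm φ (residue R ∘ d) (H.redSnd a b (u i))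
  have hmem : soc γ e s (c - ∑ i, r i • cu i) d ∈ C := by
    rw [← sub_zero d, soc_sub]
    refine C.sub_mem hcd (soc_sum_smul_zero_mem (fun i => H.soc_zero_mem (d := du i) ?_) r)
    rw [← hcu]
    exact hu i
  have hsum : residue R ∘ (∑ i, r i • cu i) =
      ∑ i, residue R (r i) • redFst γ s a b (u i) := by
    simp only [residue_comp_sum_smul, hcu, redFst_mk]
  have h0 := hC _ _ hmem fun m hm => ?_
  · refine ⟨h0.2, ?_⟩
    have h1 := h0.1
    rw [residue_comp_sub, sub_eq_zero, hsum] at h1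
    rw [h1, ← hspan]
    exact sum_mem fun i _ => smul_mem _ _ (subset_span ⟨i, rfl⟩)
  · obtain ⟨x, hx⟩ := hC.exists_sub_mem_tors hu hf hspan hm
    have hxC : m - ∑ i, x i • u i ∈ C :=
      C.sub_mem hm (sum_mem fun i _ => C.smul_mem _ (hu i))
    have h2 := H.redFst_eq_zero_of_mem_tors hx
    have h3 := horth _ ⟨_, ⟨hxC, hx⟩, rfl⟩
    obtain ⟨m', hm'⟩ : ∃ m', m' = m - ∑ i, x i • u i := ⟨_, rfl⟩
    rw [← hm'] at h2 h3
    obtain rfl : m = m' + ∑ i, x i • u i := by rw [hm', sub_add_cancel]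
    simp only [map_add, map_sum, LinearMap.map_smulₛₗ, herm_add_right, herm_sum_right,
      herm_smul_right, h2, h3, zero_add, ← Finset.sum_add_distrib, ← mul_add]
    refine Finset.sum_eq_zero fun i _ => ?_
    rw [residue_comp_sub, herm_sub_left, hsum,
      hf.herm_sum_smul_left (fun i => residue R (r i)) i]
    have := congrFun hr i
    simp only [Function.comp_apply] at this
    rw [← this]
    ring

theorem nondegenerate_codeSnd (hC : H.SocleLCD φ C) (hu : ∀ i, u i ∈ C)
    (hf : HermOrthonormal φ fun i => redFst γ s a b (u i))
    (hspan : span (ResidueField R) (Set.range fun i => redFst γ s a b (u i)) = codeFst C) :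
    HermNondegenerate φ (H.codeSnd C) := by
  rintro _ ⟨m, ⟨hm, hmt⟩, rfl⟩ horth
  obtain ⟨c, d, rfl⟩ := H.mem_tors_iff.1 hmt
  refine (hC.residue_eq_zero hu hf hspan (c := c) ?_ horth).1
  rw [← H.pow_smul_of_mem_tors]
  exact C.smul_mem _ hm

variable {v : Fin l → MixedSpace R γ s a b}

theorem exists_residue_eq (hC : H.SocleLCD φ C) (hu : ∀ i, u i ∈ C)
    (hf : HermOrthonormal φ fun i => redFst γ s a b (u i))
    (hspan : span (ResidueField R) (Set.range fun i => redFst γ s a b (u i)) = codeFst C)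
    (hv : ∀ j, v j ∈ C) (hg : HermOrthonormal φ fun j => H.redSnd a b (v j))
    (hspan' : span (ResidueField R) (Set.range fun j => H.redSnd a b (v j)) = H.codeSnd C)
    {cv : Fin l → Fin a → R} {dv : Fin l → Fin b → R}
    (hcv : ∀ j, v j = mixedMk γ s (γ ^ (e - s) • cv j, dv j))
    {c : Fin a → R} {d : Fin b → R} (hcd : soc γ e s c d ∈ C) :
    ∃ θ : Fin l → R, residue R ∘ (d - ∑ j, θ j • dv j) = 0 ∧
      residue R ∘ (c - ∑ j, θ j • cv j) ∈ codeFst C := by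
  obtain ⟨θ, hθ⟩ := exists_residue_comp_eq fun j => herm φ (residue R ∘ d) (H.redSnd a b (v j))
  refine ⟨θ, hC.residue_eq_zero hu hf hspan ?_ fun y hy => ?_⟩
  · rw [soc_sub, soc_sum_smul]
    refine C.sub_mem hcd (sum_mem fun j _ => C.smul_mem _ ?_)
    rw [← H.pow_smul_of_mem_tors, ← hcv]
    exact C.smul_mem _ (hv j)
  · rw [← hspan', mem_span_range_iff_exists_fun] at hy
    obtain ⟨x, rfl⟩ := hy
    rw [herm_sum_right]
    refine Finset.sum_eq_zero fun j _ => ?_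
    have hsum : residue R ∘ (∑ j, θ j • dv j) = ∑ j, residue R (θ j) • H.redSnd a b (v j) := by
      simp only [residue_comp_sum_smul, hcv, redSnd_mk]
    rw [herm_smul_right, residue_comp_sub, herm_sub_left, hsum,
      hg.herm_sum_smul_left (fun j => residue R (θ j)) j]
    have := congrFun hθ j
    simp only [Function.comp_apply] at this
    rw [this, sub_self, mul_zero]

/-- After reduction to the torsion part, successive approximation in both blocks at once: at each
level the leading term is a socle element of `C`, matched first by the `v j`, then by the `u i`. -/
theorem le_of_mem (hC : H.SocleLCD φ C) (hu : ∀ i, u i ∈ C)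
    (hf : HermOrthonormal φ fun i => redFst γ s a b (u i))
    (hspan : span (ResidueField R) (Set.range fun i => redFst γ s a b (u i)) = codeFst C)
    (hv : ∀ j, v j ∈ C) (hvt : ∀ j, v j ∈ tors R γ s a b)
    (hg : HermOrthonormal φ fun j => H.redSnd a b (v j))
    (hspan' : span (ResidueField R) (Set.range fun j => H.redSnd a b (v j)) = H.codeSnd C)
    {N : Submodule R (MixedSpace R γ s a b)} (hN : N ≤ C) (huN : ∀ i, u i ∈ N)
    (hvN : ∀ j, v j ∈ N) : C ≤ N := by
  intro m₀ hm₀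
  obtain ⟨r, hr⟩ := hC.exists_sub_mem_tors hu hf hspan hm₀
  have hrN : ∑ i, r i • u i ∈ N := sum_mem fun i _ => N.smul_mem _ (huN i)
  suffices ∀ m ∈ C, m ∈ tors R γ s a b → m ∈ N by
    have h1 := this _ (C.sub_mem hm₀ (hN hrN)) hr
    simpa using N.add_mem h1 hrN
  intro m hm hmt
  choose cu du hcu using fun i => mixedMk_surjective (u i)
  choose cv dv hcv using fun j => H.mem_tors_iff.1 (hvt j)
  have hlt := H.lt
  suffices ∀ n ≤ s, ∃ m₁ ∈ N, ∃ (c : Fin a → R) (d : Fin b → R),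
      m - m₁ = mixedMk γ s (γ ^ (e - s + n) • c, γ ^ n • d) by
    obtain ⟨m₁, hm₁, c, d, h⟩ := this s le_rfl
    have h1 : m - m₁ = 0 := by
      rw [h, show e - s + s = e by omega, H.pow_eq_zero, zero_smul]
      refine Prod.ext rfl (funext fun j => ?_)
      change Ideal.Quotient.mk _ (γ ^ s * d j) = 0
      rw [Ideal.Quotient.eq_zero_iff_mem, Ideal.mem_span_singleton]
      exact dvd_mul_right _ _
    rwa [sub_eq_zero.1 h1]
  intro n
  induction n with
  | zero =>
    intro _
    obtain ⟨c, d, h⟩ := H.mem_tors_iff.1 hmt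
    exact ⟨0, N.zero_mem, c, d, by simp [h]⟩
  | succ n ih =>
    intro hn
    obtain ⟨m₁, hm₁, c, d, h⟩ := ih (by omega)
    have h1 : soc γ e s c d ∈ C := by
      have h2 : γ ^ (s - 1 - n) • mixedMk γ s (γ ^ (e - s + n) • c, γ ^ n • d) ∈ C := by
        rw [← h]
        exact C.smul_mem _ (C.sub_mem hm (hN hm₁))
      rwa [← map_smul, Prod.smul_mk, smul_smul, smul_smul, ← pow_add, ← pow_add,
        show s - 1 - n + (e - s + n) = e - 1 by omega, show s - 1 - n + n = s - 1 by omega] at h2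
    obtain ⟨θ, h2, h3⟩ := hC.exists_residue_eq hu hf hspan hv hg hspan' hcv h1
    rw [← hspan, mem_span_range_iff_exists_fun] at h3
    obtain ⟨x, hx⟩ := h3
    obtain ⟨ρ, rfl⟩ := exists_residue_comp_eq x
    obtain ⟨d', hd'⟩ := H.exists_eq_smul h2
    obtain ⟨c', hc'⟩ := H.exists_eq_smul (c := c - ∑ j, θ j • cv j - ∑ i, ρ i • cu i) (by
      rw [residue_comp_sub _ (∑ i, ρ i • cu i), residue_comp_sum_smul ρ, ← hx, sub_eq_zero]
      simp only [hcu, redFst_mk]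
      rfl)
    -- The `u i` enter with `γ ^ (e - s + n)` to act at the right level of the first block. As `s <
    -- e`, their second block is divisible by `γ ^ (n + 1)` and is absorbed into the new `d`.
    refine ⟨m₁ + (γ ^ n • ∑ j, θ j • v j + γ ^ (e - s + n) • ∑ i, ρ i • u i),
      N.add_mem hm₁ (N.add_mem (N.smul_mem _ (sum_mem fun j _ => N.smul_mem _ (hvN j)))
        (N.smul_mem _ (sum_mem fun i _ => N.smul_mem _ (huN i)))), c',
      d' - γ ^ (e - s - 1) • ∑ i, ρ i • du i, ?_⟩
    rw [sub_add_eq_sub_sub, h]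
    simp only [hcu, hcv, ← map_smul, ← map_sum, ← map_sub, ← map_add]
    congr 1
    refine Prod.ext ?_ ?_
    · have h6 : ∑ j, θ j • γ ^ (e - s) • cv j = γ ^ (e - s) • ∑ j, θ j • cv j := by
        rw [Finset.smul_sum]
        exact Finset.sum_congr rfl fun j _ => smul_comm _ _ _
      rw [← add_assoc, pow_succ, mul_smul, ← hc']
      simp only [Prod.fst_sub, Prod.fst_add, Prod.smul_fst, Prod.fst_sum]
      rw [h6, smul_smul (γ ^ n), ← pow_add, add_comm n, smul_sub, smul_sub]
      abel
    · have h5 : γ ^ (n + 1) • γ ^ (e - s - 1) • ∑ i, ρ i • du i =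
          γ ^ (e - s + n) • ∑ i, ρ i • du i := by
        rw [smul_smul, ← pow_add]
        congr 2
        omega
      rw [smul_sub, h5, pow_succ, mul_smul, ← hd']
      simp only [Prod.snd_sub, Prod.snd_add, Prod.smul_snd, Prod.snd_sum, smul_sub]
      abel

theorem exists_frame [Finite R] {q : ℕ} (hq : IsQuadraticFrobenius φ q) (hC : H.SocleLCD φ C) :
    ∃ (t : (Fin (Module.finrank (ResidueField R) (codeFst C)) → MixedSpace R γ s a b) ×
        (Fin (Module.finrank (ResidueField R) (H.codeSnd C)) → MixedSpace R γ s a b))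
      (ht : H.IsFrame φ t), LinearMap.range (frameMap t ht.tors) = C := by
  have : Finite (ResidueField R) := Finite.of_surjective _ residue_surjective
  obtain ⟨f, hf, hfs⟩ := hC.nondegenerate_codeFst.exists_frame hq
  have hfC (i) : ∃ m ∈ C, redFst γ s a b m = f i := by
    have h1 : f i ∈ codeFst C := hfs ▸ subset_span ⟨i, rfl⟩
    exact h1
  choose u hu huf using hfC
  obtain rfl : (fun i => redFst γ s a b (u i)) = f := funext huf
  obtain ⟨g, hg, hgs⟩ := (hC.nondegenerate_codeSnd hu hf hfs).exists_frame hq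
  have hgC (j) : ∃ m, (m ∈ C ∧ m ∈ tors R γ s a b) ∧ H.redSnd a b m = g j := by
    have h1 : g j ∈ H.codeSnd C := hgs ▸ subset_span ⟨j, rfl⟩
    exact h1
  choose v hv hvg using hgC
  obtain rfl : (fun j => H.redSnd a b (v j)) = g := funext hvg
  have ht : H.IsFrame φ (u, v) := ⟨hf, fun j => (hv j).2, hg⟩
  refine ⟨(u, v), ht, ?_⟩
  have hle : LinearMap.range (frameMap (u, v) ht.tors) ≤ C := by
    rintro _ ⟨z, rfl⟩
    obtain ⟨r, x, rfl⟩ := mixedMk_surjective z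
    rw [frameMap_mk]
    exact C.add_mem (sum_mem fun i _ => C.smul_mem _ (hu i))
      (sum_mem fun j _ => C.smul_mem _ (hv j).1)
  exact le_antisymm hle (hC.le_of_mem hu hf hfs (fun j => (hv j).1) (fun j => (hv j).2) hg hgs hle
    ht.fst_mem_range ht.snd_mem_range)

end SocleLCD

end IsChainGenerator

end FrameOfLCD

/-! ### Double counting of frames and codes -/

section CountLCD

open IsLocalRing Submodule

theorem hermNondegenerate_top {K : Type*} [Field K] (φ : K →+* K) (n : ℕ) :
    HermNondegenerate φ (⊤ : Submodule K (Fin n → K)) := by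
  intro x _ h
  ext i
  simpa [herm, Pi.single_apply, apply_ite φ] using h (Pi.single i 1) trivial

theorem finite_mixedSpace {R : Type*} [CommRing R] [Finite R] (γ : R) (s a b : ℕ) :
    Finite (MixedSpace R γ s a b) := by
  have : Finite (RCheck R γ s) := Finite.of_surjective _ Ideal.Quotient.mk_surjective
  infer_instance

variable {R : Type*} [CommRing R] [IsLocalRing R] {γ : R} {e s : ℕ}

namespace IsChainGenerator

/-- The type of frames. -/
abbrev Frames (H : IsChainGenerator γ e s) (φ : ResidueField R →+* ResidueField R)
    (a b k l : ℕ) : Type _ :=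
  {t : (Fin k → MixedSpace R γ s a b) × (Fin l → MixedSpace R γ s a b) // H.IsFrame φ t}

variable {H : IsChainGenerator γ e s} {φ : ResidueField R →+* ResidueField R} {a b k l : ℕ}

/-- Inclusion suffices, since both codes are injective images of the same finite module. -/
theorem IsFrame.range_eq_iff [Finite R] {t t' : (Fin k → MixedSpace R γ s a b) ×
    (Fin l → MixedSpace R γ s a b)} (ht : H.IsFrame φ t) (ht' : H.IsFrame φ t') :
    LinearMap.range (frameMap t' ht'.tors) = LinearMap.range (frameMap t ht.tors) ↔
      (∀ i, t'.1 i ∈ LinearMap.range (frameMap t ht.tors)) ∧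
        ∀ j, t'.2 j ∈ LinearMap.range (frameMap t ht.tors) := by
  constructor
  · intro h
    rw [← h]
    exact ⟨ht'.fst_mem_range, ht'.snd_mem_range⟩
  · rintro ⟨h1, h2⟩
    have := finite_mixedSpace γ s a b
    have hle : LinearMap.range (frameMap t' ht'.tors) ≤ LinearMap.range (frameMap t ht.tors) := by
      rintro _ ⟨z, rfl⟩
      obtain ⟨r, x, rfl⟩ := mixedMk_surjective z
      rw [frameMap_mk]
      exact Submodule.add_mem _ (sum_mem fun i _ => smul_mem _ _ (h1 i))
        (sum_mem fun j _ => smul_mem _ _ (h2 j))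
    refine SetLike.coe_injective (Set.eq_of_subset_of_ncard_le hle ?_)
    rw [LinearMap.coe_range, LinearMap.coe_range, ← Set.image_univ, ← Set.image_univ,
      Set.ncard_image_of_injective _ ht.frameMap_injective,
      Set.ncard_image_of_injective _ ht'.frameMap_injective]

/-- The frames spanning the same code as a given one. -/
noncomputable def IsFrame.fiberEquiv [Finite R] {t : (Fin k → MixedSpace R γ s a b) ×
    (Fin l → MixedSpace R γ s a b)} (ht : H.IsFrame φ t) :
    {t' : H.Frames φ a b k l //
      LinearMap.range (frameMap t'.1 t'.2.tors) = LinearMap.range (frameMap t ht.tors)} ≃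
      H.Frames φ k l k l :=
  have hp (t' : {t' : H.Frames φ a b k l //
      LinearMap.range (frameMap t'.1 t'.2.tors) = LinearMap.range (frameMap t ht.tors)}) :=
    (ht.range_eq_iff t'.1.2).1 t'.2
  { toFun := fun t' =>
      ⟨(fun i => ((hp t').1 i).choose, fun j => ((hp t').2 j).choose), by
        rw [← ht.comp_iff]
        have h1 (i) := ((hp t').1 i).choose_spec
        have h2 (j) := ((hp t').2 j).choose_spec
        simp only [h1, h2]
        exact t'.1.2⟩
    invFun := fun t' =>
      ⟨⟨(fun i => frameMap t ht.tors (t'.1.1 i), fun j => frameMap t ht.tors (t'.1.2 j)),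
        ht.comp_iff.2 t'.2⟩,
        (ht.range_eq_iff (ht.comp_iff.2 t'.2)).2 ⟨fun i => ⟨_, rfl⟩, fun j => ⟨_, rfl⟩⟩⟩
    left_inv := fun t' => by
      have h1 (i) := ((hp t').1 i).choose_spec
      have h2 (j) := ((hp t').2 j).choose_spec
      exact Subtype.ext (Subtype.ext (Prod.ext (funext h1) (funext h2)))
    right_inv := fun t' => by
      refine Subtype.ext (Prod.ext (funext fun i => ?_) (funext fun j => ?_))
      · exact ht.frameMap_injective (Exists.choose_spec (p := fun z => frameMap t ht.tors z = _) _)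
      · exact ht.frameMap_injective (Exists.choose_spec (p := fun z => frameMap t ht.tors z = _) _) }

/-- The LCD codes of type `(k, l)`. -/
abbrev LCDCodes (H : IsChainGenerator γ e s) (φ : ResidueField R →+* ResidueField R)
    (a b k l : ℕ) : Type _ :=
  {C : Submodule R (MixedSpace R γ s a b) // H.SocleLCD φ C ∧
    Module.finrank (ResidueField R) (codeFst C) = k ∧
    Module.finrank (ResidueField R) (H.codeSnd C) = l}

variable [Finite R] {q : ℕ}

/-- Map a frame to the code it generates: the map is onto the LCD codes of type `(k, l)`, and each
fibre is in bijection with the frames of the model space. -/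
theorem card_frames_eq_mul (hq : IsQuadraticFrobenius φ q) :
    Nat.card (H.Frames φ a b k l) = Nat.card (H.LCDCodes φ a b k l) *
      Nat.card (H.Frames φ k l k l) := by
  let F : H.Frames φ a b k l → H.LCDCodes φ a b k l := fun t =>
    ⟨LinearMap.range (frameMap t.1 t.2.tors), t.2.socleLCD, t.2.finrank_codeFst,
      t.2.finrank_codeSnd⟩
  have := finite_mixedSpace γ s a b
  have := Fintype.ofFinite (H.LCDCodes φ a b k l)
  have hF (C : H.LCDCodes φ a b k l) : Nat.card {t // F t = C} = Nat.card (H.Frames φ k l k l) := by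
    obtain ⟨C, hC, rfl, rfl⟩ := C
    obtain ⟨t, ht, hrange⟩ := hC.exists_frame hq
    rw [← Nat.card_congr ht.fiberEquiv]
    refine Nat.card_congr (Equiv.subtypeEquivRight fun t' => ?_)
    rw [Subtype.ext_iff, hrange]
  rw [← Nat.card_congr (Equiv.sigmaFiberEquiv F), Nat.card_sigma,
    Finset.sum_congr rfl fun C _ => hF C, Finset.sum_const, Finset.card_univ, smul_eq_mul,
    Nat.card_eq_fintype_card (α := H.LCDCodes φ a b k l)]

omit [Finite R] in
theorem redFst_surjective : Function.Surjective (redFst γ s a b) := by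
  intro x
  obtain ⟨c, rfl⟩ := exists_residue_comp_eq x
  exact ⟨mixedMk γ s (c, 0), rfl⟩

omit [Finite R] in
theorem exists_mem_tors_redSnd_eq (H : IsChainGenerator γ e s) (x : Fin b → ResidueField R) :
    ∃ m ∈ tors R γ s a b, H.redSnd a b m = x := by
  obtain ⟨d, rfl⟩ := exists_residue_comp_eq x
  exact ⟨mixedMk γ s (γ ^ (e - s) • 0, d), H.mem_tors_iff.2 ⟨0, d, rfl⟩, rfl⟩

theorem card_hermOrthonormal (hq : IsQuadraticFrobenius φ q) {n r : ℕ} (hr : r ≤ n) :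
    (Nat.card {f : Fin r → Fin n → ResidueField R // HermOrthonormal φ f} : ℚ) =
      hermFrameCount q n r := by
  have : Finite (ResidueField R) := Finite.of_surjective _ residue_surjective
  rw [← card_hermFrames hq (hermNondegenerate_top φ n) (by simp) hr]
  exact congrArg _ (Nat.card_congr (Equiv.subtypeEquivRight fun f => by simp))

theorem card_frames (hq : IsQuadraticFrobenius φ q) (hk : k ≤ a) (hl : l ≤ b) :
    (Nat.card (H.Frames φ a b k l) : ℚ) * ((q : ℚ) ^ 2) ^ (a * k + b * l) =
      hermFrameCount q a k * hermFrameCount q b l *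
        ((q : ℚ) ^ 2) ^ ((e * a + s * b) * k + (s * a + s * b) * l) := by
  have : Finite (ResidueField R) := Finite.of_surjective _ residue_surjective
  have hK : Nat.card (ResidueField R) = q ^ 2 := hq.card
  let f : MixedSpace R γ s a b →+ (Fin a → ResidueField R) := (redFst γ s a b).toAddMonoidHom
  let g : tors R γ s a b →+ (Fin b → ResidueField R) :=
    (H.redSnd a b).toAddMonoidHom.comp (tors R γ s a b).subtype.toAddMonoidHom
  have hf : Function.Surjective f := redFst_surjective
  have hg : Function.Surjective g := fun x => by
    obtain ⟨m, hm, hx⟩ := H.exists_mem_tors_redSnd_eq (a := a) x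
    exact ⟨⟨m, hm⟩, hx⟩
  -- The conditions on the two families are independent, so each is counted as lifts along its own
  -- reduction map.
  have E : H.Frames φ a b k l ≃ {u : Fin k → MixedSpace R γ s a b // HermOrthonormal φ (f ∘ u)} ×
      {v : Fin l → tors R γ s a b // HermOrthonormal φ (g ∘ v)} :=
    { toFun := fun t => (⟨t.1.1, t.2.fst⟩, ⟨fun j => ⟨t.1.2 j, t.2.tors j⟩, t.2.snd⟩)
      invFun := fun p => ⟨(p.1.1, fun j => (p.2.1 j).1), p.1.2, fun j => (p.2.1 j).2, p.2.2⟩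
      left_inv := fun t => rfl
      right_inv := fun p => rfl }
  have := finite_mixedSpace γ s a b
  have h1 := Nat.card_comp_mul f hf (k := k) (HermOrthonormal φ)
  have h2 := Nat.card_comp_mul g hg (k := l) (HermOrthonormal φ)
  rw [Nat.card_fun, Nat.card_fin, H.card_mixedSpace, hK] at h1
  rw [Nat.card_fun, Nat.card_fin, H.card_tors, hK] at h2
  have h1' := congrArg (Nat.cast : ℕ → ℚ) h1
  have h2' := congrArg (Nat.cast : ℕ → ℚ) h2
  push_cast at h1' h2'
  rw [card_hermOrthonormal hq hk] at h1'
  rw [card_hermOrthonormal hq hl] at h2'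
  rw [Nat.card_congr E, Nat.card_prod, Nat.cast_mul, pow_add, pow_add, pow_mul _ a, pow_mul _ b,
    pow_mul _ _ k, pow_mul _ _ l]
  rw [mul_mul_mul_comm, h1', h2', mul_mul_mul_comm]

theorem card_lcdCodes (hq : IsQuadraticFrobenius φ q) (hk : k ≤ a) (hl : l ≤ b) :
    (Nat.card (H.LCDCodes φ a b k l) : ℚ) = hermitianCount q a k * hermitianCount q b l *
      ((q : ℚ) ^ 2) ^ ((a - k) * (s * l + (e - 1) * k) + (b - l) * (s * k + (s - 1) * l)) := by
  have : Finite (ResidueField R) := Finite.of_surjective _ residue_surjective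
  have hq2 := hq.two_le
  have hQ : ((q : ℚ) ^ 2) ≠ 0 := by positivity
  have h1 := card_frames (H := H) hq hk hl
  have h2 := card_frames (H := H) hq (le_refl k) (le_refl l)
  rw [card_frames_eq_mul hq, Nat.cast_mul, ← hermitianCount_mul hq2 hk,
    ← hermitianCount_mul hq2 hl] at h1
  have hk0 := (hermFrameCount_pos hq2 (le_refl k)).ne'
  have hl0 := (hermFrameCount_pos hq2 (le_refl l)).ne'
  -- Comparison of lift exponents for block-lengths `(a, b)` and `(k, l)`, arranged without dividing
  -- powers of `q`.
  have hexp : (e * a + s * b) * k + (s * a + s * b) * l + (k * k + l * l) =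
      (a - k) * (s * l + (e - 1) * k) + (b - l) * (s * k + (s - 1) * l) +
        ((e * k + s * l) * k + (s * k + s * l) * l + (a * k + b * l)) := by
    obtain ⟨a', rfl⟩ := Nat.exists_eq_add_of_le hk
    obtain ⟨b', rfl⟩ := Nat.exists_eq_add_of_le hl
    obtain ⟨s', rfl⟩ := Nat.exists_eq_add_of_le H.pos
    obtain ⟨e', rfl⟩ := Nat.exists_eq_add_of_le (show 1 ≤ e from H.pos.trans H.lt)
    simp only [Nat.add_sub_cancel_left]
    ring
  have hexp' := congrArg (fun n => ((q : ℚ) ^ 2) ^ n) hexp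
  rw [pow_add _ _ (k * k + l * l), pow_add _ ((a - k) * _ + _),
    pow_add _ ((e * k + s * l) * k + (s * k + s * l) * l)] at hexp'
  generalize ((q : ℚ) ^ 2) ^ ((a - k) * (s * l + (e - 1) * k) + (b - l) * (s * k + (s - 1) * l)) = A
    at *
  have hB : ((q : ℚ) ^ 2) ^ ((e * k + s * l) * k + (s * k + s * l) * l) ≠ 0 := _root_.pow_ne_zero _ hQ
  have hD : ((q : ℚ) ^ 2) ^ (a * k + b * l) ≠ 0 := _root_.pow_ne_zero _ hQ
  generalize ((q : ℚ) ^ 2) ^ ((e * k + s * l) * k + (s * k + s * l) * l) = B at *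
  generalize ((q : ℚ) ^ 2) ^ (a * k + b * l) = D at *
  generalize ((q : ℚ) ^ 2) ^ ((e * a + s * b) * k + (s * a + s * b) * l) = E at *
  generalize ((q : ℚ) ^ 2) ^ (k * k + l * l) = G at *
  generalize hermFrameCount q k k = T at *
  generalize hermFrameCount q l l = T' at *
  have hne : T * T' * B * D ≠ 0 := mul_ne_zero (mul_ne_zero (mul_ne_zero hk0 hl0) hB) hD
  apply mul_right_cancel₀ hne
  linear_combination G * h1 - (Nat.card (H.LCDCodes φ a b k l) : ℚ) * D * h2 +
    hermitianCount q a k * hermitianCount q b l * T * T' * hexp'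

theorem card_socleLCD (H : IsChainGenerator γ e s) (hq : IsQuadraticFrobenius φ q) (a b : ℕ) :
    (Nat.card {C : Submodule R (MixedSpace R γ s a b) // H.SocleLCD φ C} : ℚ) =
      ∑ k ∈ Finset.range (a + 1), ∑ l ∈ Finset.range (b + 1),
        hermitianCount q a k * hermitianCount q b l *
          ((q : ℚ) ^ 2) ^ ((a - k) * (s * l + (e - 1) * k) + (b - l) * (s * k + (s - 1) * l)) := by
  have hle {n : ℕ} (W : Submodule (ResidueField R) (Fin n → ResidueField R)) :
      Module.finrank (ResidueField R) W < n + 1 := by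
    have := W.finrank_le
    rw [Module.finrank_fin_fun] at this
    omega
  let F : {C : Submodule R (MixedSpace R γ s a b) // H.SocleLCD φ C} → Fin (a + 1) × Fin (b + 1) :=
    fun C => (⟨_, hle (codeFst C.1)⟩, ⟨_, hle (H.codeSnd C.1)⟩)
  have hF (p : Fin (a + 1) × Fin (b + 1)) :
      Nat.card {C // F C = p} = Nat.card (H.LCDCodes φ a b p.1 p.2) := by
    refine Nat.card_congr ((Equiv.subtypeSubtypeEquivSubtypeInter (H.SocleLCD φ) fun C =>
      Module.finrank (ResidueField R) (codeFst C) = p.1 ∧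
        Module.finrank (ResidueField R) (H.codeSnd C) = p.2).symm.trans
      (Equiv.subtypeEquivRight fun C => ?_)).symm
    rw [Prod.ext_iff, Fin.ext_iff, Fin.ext_iff]
  have := finite_mixedSpace γ s a b
  rw [← Nat.card_congr (Equiv.sigmaFiberEquiv F), Nat.card_sigma, Nat.cast_sum,
    Finset.sum_congr rfl fun p _ => congrArg Nat.cast (hF p), Fintype.sum_prod_type,
    Finset.sum_range]
  refine Finset.sum_congr rfl fun k _ => ?_
  rw [Finset.sum_range]
  exact Finset.sum_congr rfl fun l _ =>
    card_lcdCodes hq (Nat.lt_succ_iff.1 k.2) (Nat.lt_succ_iff.1 l.2)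

end IsChainGenerator

end CountLCD

/-! ### The counting theorem -/

theorem mainTheorem5 {S R : Type*} [CommRing S] [Finite S] [IsChainRing S]
    [CommRing R] [Finite R] [IsChainRing R] [Algebra S R]
    (w : ℕ) (hw : 2 ≤ w) (hw_even : Even w) (hSR : IsGaloisExtensionOfDegree S R w)
    (σ : R ≃ₐ[S] R) (hσ : ∀ τ : R ≃ₐ[S] R, τ ∈ Subgroup.zpowers σ)
    (γ : R) (hγ : IsLocalRing.maximalIdeal R = Ideal.span {γ})
    (e : ℕ) (he : 2 ≤ e) (hγe : IsLeast {k : ℕ | γ ^ k = 0} e)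
    (s : ℕ) (hs : 0 < s) (hse : s < e)
    (a b : ℕ) (ha : 0 < a) (hb : 0 < b) :
    ∃ q₁ : ℕ, IsPrimePow q₁ ∧ Nat.card (IsLocalRing.ResidueField R) = q₁ ^ 2 ∧
      (Nat.card {C : Submodule R (MixedSpace R γ s a b) //
          IsGaloisLCD σ (w / 2) γ e s C} : ℚ) =
        ∑ k₀ ∈ Finset.range (a + 1), ∑ l₀ ∈ Finset.range (b + 1),
          hermitianCount q₁ a k₀ * hermitianCount q₁ b l₀ *
            ((q₁ : ℚ) ^ 2) ^
              ((a - k₀) * (s * l₀ + (e - 1) * k₀) + (b - l₀) * (s * k₀ + (s - 1) * l₀)) := by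
  obtain ⟨q, φ, hprime, hq, hφ⟩ := exists_isQuadraticFrobenius hw hw_even hSR σ hσ
  have H : IsChainGenerator γ e s :=
    ⟨hγ, hγe.1, fun i hi h => absurd (hγe.2 h) (by omega), hs, hse⟩
  refine ⟨q, hprime, hq.card, ?_⟩
  rw [← H.card_socleLCD hq a b]
  refine congrArg _ (Nat.card_congr (Equiv.subtypeEquivRight fun C => ?_))
  exact H.lcd_iff (τ := (σ ^ (w / 2) : R ≃ₐ[S] R).toRingEquiv) hφ C
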